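/- Let $X$ be a set and let $\Psi$ be a non-empty collection of test functions on $X$, that is, of functions $\psi:X\to\mathbb C$ such that $\sup_{\psi\in\Psi}|\psi(x)|<1$ for every $x\in X$ and such that, for every finite $F\subset X$, the restrictions $\psi|_F$ ($\psi\in\Psi$) together with the constants generate the algebra of all complex functions on $F$. Give $\Psi$ the topology of pointwise convergence on $X$, let $C_b(\Psi)$ be the algebra of bounded continuous complex functions on $\Psi$, and let $E(x)\in C_b(\Psi)$ be $E(x)(\psi)=\psi(x)$. Let $\mathcal E$ be a complex Hilbert space. For a set $Z\subset X$, a function $k:Z\times Z\to\mathcal B(\mathcal E)$ is a positive kernel on $Z$ if $\sum_{i,j=1}^n\langle k(x_i,x_j)e_j,e_i\rangle\ge 0$ for all $n$, all $x_1,\dots,x_n\in Z$ and all $e_1,\dots,e_n\in\mathcal E$; $\mathcal K_\Psi(Z)$ is the set of positive kernels $k$ on $Z$ such that $(1-\psi(x)\overline{\psi(y)})k(x,y)$ is a positive kernel on $Z$ for each $\psi\in\Psi$. A function $f:Z\to\mathcal B(\mathcal E)$ is $\Psi$-Herglotz–Agler on $Z$ if $f(x)k(x,y)+k(x,y)f(y)^*$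 is a positive kernel on $Z$ for each $k\in\mathcal K_\Psi(Z)$; it is $\Psi$-Herglotz–Agler on $Z$ in the tensor sense if $(f(x)+f(y)^*)\otimes k(x,y)$ is a positive $\mathcal B(\mathcal E\otimes\mathcal E)$-valued kernel on $Z$ for each $k\in\mathcal K_\Psi(Z)$. A map $\Lambda:X\times X\to\mathcal B(C_b(\Psi),\mathcal B(\mathcal E))$ is a completely positive kernel if $\sum_{i,j=1}^n T_i^*\Lambda(x_i,x_j)(\overline{g_i}g_j)T_j\ge 0$ for all $n$, $x_i\in X$, $T_i\in\mathcal B(\mathcal E)$ and $g_i\in C_b(\Psi)$. Let $Y\subset X$ and let $f:Y\to\mathcal B(\mathcal E)$ be $\Psi$-Herglotz–Agler on $Y$. Then the following are equivalent: (1) there is a function $F:X\to\mathcal B(\mathcal E)$ that is $\Psi$-Herglotz–Agler on $X$ with $F|_Y=f$; (2) there is a completely positive kernel $\Lambda:X\times X\to\mathcal B(C_b(\Psi),\mathcal B(\mathcal E))$ such that $$f(x)+f(y)^*=\Lambda(x,y)\bigl(1-E(x)\overline{E(y)}\bigr)\qquad\text{for all }x,y\in Y.$$ Moreover, for an arbitrary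 function $f:Y\to\mathcal B(\mathcal E)$, (2) is equivalent to (1) with "$\Psi$-Herglotz–Agler" taken in the tensor sense. -/

import Mathlib

open scoped ComplexOrder BoundedContinuousFunction

namespace HerglotzAgler

/-- A collection `Ψ` of complex functions on a set `Z` is a collection of test functions:
`sup_{ψ ∈ Ψ} |ψ z| < 1` for each `z`, and on each finite subset `F` of `Z` the restrictions of
the members of `Ψ`, together with the constants, generate the algebra of all functions on `F`. -/
structure IsTestFamily {Z : Type*} (Ψ : Set (Z → ℂ)) : Prop where
  sup_lt_one : ∀ z : Z, ∃ r : ℝ, r < 1 ∧ ∀ ψ ∈ Ψ, ‖ψ z‖ ≤ r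
  generates : ∀ F : Finset Z,
    Algebra.adjoin ℂ ((fun (ψ : Z → ℂ) (z : F) => ψ z) '' Ψ) = ⊤

/-- The evaluation function `E(z) = e_z`, `e_z(ψ) = ψ z`, as a member of `C_b(Ψ)`, where `Ψ`
carries the topology of pointwise convergence. -/
noncomputable def evalFn {Z : Type*} {Ψ : Set (Z → ℂ)} (hΨ : IsTestFamily Ψ) (z : Z) :
    Ψ →ᵇ ℂ :=
  BoundedContinuousFunction.ofNormedAddCommGroup (fun ψ : Ψ => ψ.1 z)
    ((continuous_apply z).comp continuous_subtype_val) 1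
    (fun ψ => by
      obtain ⟨r, hr, h⟩ := hΨ.sup_lt_one z
      exact (h ψ.1 ψ.2).trans hr.le)

/-- The restrictions to `Y` of the members of `Ψ`. -/
def restrictFamily {X : Type*} (Ψ : Set (X → ℂ)) (Y : Set X) : Set (Y → ℂ) :=
  (fun (ψ : X → ℂ) (y : Y) => ψ y) '' Ψ

section Kernels

variable {Z E : Type*} [NormedAddCommGroup E] [InnerProductSpace ℂ E]

/-- Positive kernels with values in `B(E)`: the sums of `⟨k(z_i, z_j) e_j, e_i⟩` are
non-negative. (Mathlib's inner product is linear in its second argument.) -/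
def IsPositiveKernel (k : Z → Z → E →L[ℂ] E) : Prop :=
  ∀ (n : ℕ) (z : Fin n → Z) (e : Fin n → E),
    0 ≤ ∑ i, ∑ j, inner ℂ (e i) (k (z i) (z j) (e j))

/-- The class `K_Ψ(E)`: positive kernels `k` such that `(1 - ψ(x) conj ψ(y)) k(x, y)` is a
positive kernel for each `ψ ∈ Ψ`. -/
def IsAdmissibleKernel (Ψ : Set (Z → ℂ)) (k : Z → Z → E →L[ℂ] E) : Prop :=
  IsPositiveKernel k ∧
    ∀ ψ ∈ Ψ, IsPositiveKernel (fun x y => (1 - ψ x * star (ψ y)) • k x y)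

variable [CompleteSpace E]

/-- The `Ψ`-Herglotz-Agler class: `f(x) k(x, y) + k(x, y) f(y)^*` (operator products in `B(E)`)
is a positive kernel for each `k` in `K_Ψ(E)`. -/
def IsHerglotzAgler (Ψ : Set (Z → ℂ)) (f : Z → E →L[ℂ] E) : Prop :=
  ∀ k : Z → Z → E →L[ℂ] E, IsAdmissibleKernel Ψ k →
    IsPositiveKernel (fun x y => f x ∘L k x y + k x y ∘L ContinuousLinearMap.adjoint (f y))

/-- The `Ψ`-Herglotz-Agler class in the tensor sense: `(f(x) + f(y)^*) ⊗ k(x, y)` is a positive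
`B(E ⊗ E)`-valued kernel for each `k` in `K_Ψ(E)`. As the points `z_i` may repeat, it is enough
to test positivity on elementary tensors `u_i ⊗ e_i`. -/
def IsTensorHerglotzAgler (Ψ : Set (Z → ℂ)) (f : Z → E →L[ℂ] E) : Prop :=
  ∀ k : Z → Z → E →L[ℂ] E, IsAdmissibleKernel Ψ k →
    ∀ (n : ℕ) (z : Fin n → Z) (u e : Fin n → E),
      0 ≤ ∑ i, ∑ j,
        inner ℂ (u i) ((f (z i) + ContinuousLinearMap.adjoint (f (z j))) (u j)) *
          inner ℂ (e i) (k (z i) (z j) (e j))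

/-- Completely positive kernels `Λ : Z × Z → B(C_b(Ψ), B(E))`. -/
def IsCompletelyPositiveKernel {Ψ : Set (Z → ℂ)}
    (Λ : Z → Z → (Ψ →ᵇ ℂ) →L[ℂ] (E →L[ℂ] E)) : Prop :=
  ∀ (n : ℕ) (z : Fin n → Z) (T : Fin n → E →L[ℂ] E) (g : Fin n → Ψ →ᵇ ℂ),
    (∑ i, ∑ j, ContinuousLinearMap.adjoint (T i) ∘L
      Λ (z i) (z j) (star (g i) * g j) ∘L T j).IsPositive

end Kernels

/-- There is a completely positive kernel `Λ` on `X` with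
`f(x) + f(y)^* = Λ(x, y)(1 - E(x) conj E(y))` for all `x, y ∈ Y`. -/
def HasDecompositionOn {X E : Type*} [NormedAddCommGroup E] [InnerProductSpace ℂ E]
    [CompleteSpace E] {Ψ : Set (X → ℂ)} (hΨ : IsTestFamily Ψ) (Y : Set X)
    (f : Y → E →L[ℂ] E) : Prop :=
  ∃ Λ : X → X → (Ψ →ᵇ ℂ) →L[ℂ] (E →L[ℂ] E), IsCompletelyPositiveKernel Λ ∧
    ∀ x y : Y, f x + ContinuousLinearMap.adjoint (f y) =
      Λ x y (1 - evalFn hΨ x * star (evalFn hΨ y))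

end HerglotzAgler

/-! (2) ⇒ (1), tensor sense, is a lurking isometry argument. A Kolmogorov decomposition `Λ(x,y)(g) =
D_x^* ρ(g) D_y` with a *-representation `ρ` of `C_b(Ψ)` (`exists_representation`), together with
disc automorphisms that move the values at a base point `x₀ ∈ Y` to `0` (`exists_normalization`),
gives `f(x) + f(y)^* = D_x^* D_y - (R_x D_x)^* (R_y D_y)` on `Y`, with `‖R_x‖ < 1` on `X` and
`R_{x₀} = 0`. The vectors `R_x D_x u` and `(D_x - D_{x₀}) u` then have equal Gram matrices, so some
contraction `W` satisfies `(1 - W R_x) D_x = D_{x₀}`. Solving for `D_x` makes sense at every point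
of `X`, and `F(x) = D_x^* D_{x₀} - f(x₀)^*` extends `f`. Its positivity is a Schur product argument:
admissible scalar matrices factor as `C^* C` over `C_b(Ψ)`, and `ρ` carries this to positivity in
`H` (`exists_schur_extension`).

(1) ⇒ (2), tensor sense, is a cone extension argument. On formal kernels whose coefficients are
multiples of `1 - E(x) conj E(y)`, pairing with `f(x) + f(y)^*` is a linear functional, and the
tensor condition makes it non-negative in real part on those with positive evaluations
(`sum_pairing_nonneg`). The Riesz extension theorem extends it to all formal kernels
(`exists_positive_functional`). Read as a sesquilinear form in the vectors, the extension is `Λ`.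

With operator products, testing against rank-one kernels supported at one point shows that each
`f(x)` is a scalar multiple of the identity (`exists_eq_smul_one`). This class is thus contained in
the tensor class, and for (2) ⇒ (1) `Λ` is compressed to a unit vector so that the extension is also
scalar. -/

namespace HerglotzAgler

/-! ### Contractions from Gram matrices; the lurking isometry. -/

section Hilbert

variable {H : Type*} [NormedAddCommGroup H] [InnerProductSpace ℂ H] [CompleteSpace H]

/-- Two families of vectors with the same Gram matrix are related by a contraction. -/
theorem exists_contraction_of_gram_eq {ι : Type*} (a b : ι → H)
    (h : ∀ i j, inner ℂ (a i) (a j) = inner ℂ (b i) (b j)) :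
    ∃ W : H →L[ℂ] H, ‖W‖ ≤ 1 ∧ ∀ i, W (a i) = b i := by
  classical
  set A := Finsupp.linearCombination ℂ a
  set B := Finsupp.linearCombination ℂ b
  have hAB : ∀ c, ‖B c‖ = ‖A c‖ := by
    intro c
    have : inner ℂ (B c) (B c) = inner ℂ (A c) (A c) := by
      simp only [A, B, Finsupp.linearCombination_apply, Finsupp.sum, sum_inner, inner_sum,
        inner_smul_left, inner_smul_right, h]
    rw [inner_self_eq_norm_sq_to_K, inner_self_eq_norm_sq_to_K] at this
    have h2 : ‖B c‖ ^ 2 = ‖A c‖ ^ 2 := by exact_mod_cast this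
    exact (sq_eq_sq₀ (norm_nonneg _) (norm_nonneg _)).1 h2
  let M : Submodule ℂ H := (LinearMap.range A).topologicalClosure
  have : CompleteSpace M := (Submodule.isClosed_topologicalClosure _).completeSpace_coe
  let A' : (ι →₀ ℂ) →ₗ[ℂ] M :=
    A.codRestrict M fun c => Submodule.le_topologicalClosure _ (LinearMap.mem_range_self A c)
  have hd : DenseRange A' := by
    intro m
    have hm : (m : H) ∈ closure (LinearMap.range A : Set H) := m.2
    rw [closure_subtype]
    convert! hm
    ext z
    constructor
    · rintro ⟨_, ⟨c, rfl⟩, rfl⟩; exact ⟨c, rfl⟩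
    · rintro ⟨c, rfl⟩; exact ⟨_, ⟨c, rfl⟩, rfl⟩
  have hn : ∀ c, ‖B c‖ ≤ 1 * ‖A' c‖ := fun c => by rw [one_mul, hAB]; rfl
  -- `W` is the isometry `A c ↦ B c` on the closed span of the `a i`, and zero on its orthogonal
  -- complement.
  refine ⟨(B.extendOfNorm A') ∘L M.orthogonalProjectionOnto, ?_, fun i => ?_⟩
  · refine (ContinuousLinearMap.opNorm_comp_le _ _).trans ?_
    refine mul_le_one₀ (LinearMap.opNorm_extendOfNorm_le hd zero_le_one hn) (norm_nonneg _)
      (Submodule.orthogonalProjectionOnto_norm_le _)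
  · have h1 : a i = (A' (Finsupp.single i 1) : H) := by simp [A', A]
    rw [h1, ContinuousLinearMap.comp_apply, Submodule.orthogonalProjectionOnto_mem_subspace_eq_self,
      LinearMap.extendOfNorm_eq hd ⟨1, hn⟩]
    simp [B]

variable {E : Type*} [NormedAddCommGroup E] [InnerProductSpace ℂ E] [CompleteSpace E]

/-- Lurking isometry argument for Herglotz functions. -/
theorem exists_extension_of_realization {X : Type*} {Y : Set X} (f : Y → E →L[ℂ] E)
    (D : Y → E →L[ℂ] H) (R : X → H →L[ℂ] H) (hR : ∀ x, ‖R x‖ < 1) (x₀ : Y) (hx₀ : R x₀ = 0)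
    (hf : ∀ (x y : Y) (u v : E),
      inner ℂ u ((f x + ContinuousLinearMap.adjoint (f y)) v) =
        inner ℂ (D x u) (D y v) - inner ℂ (R x (D x u)) (R y (D y v))) :
    ∃ (F : X → E →L[ℂ] E) (D' : X → E →L[ℂ] H) (W : H →L[ℂ] H), ‖W‖ ≤ 1 ∧
      (∀ y : Y, F y = f y) ∧
      ∀ (x y : X) (u v : E),
        inner ℂ u ((F x + ContinuousLinearMap.adjoint (F y)) v) =
          inner ℂ (D' x u) (D' y v) - inner ℂ (W (R x (D' x u))) (W (R y (D' y v))) := by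
  have hf' : ∀ (x y : Y) (u v : E), inner ℂ u (f x v) + inner ℂ (f y u) v =
      inner ℂ (D x u) (D y v) - inner ℂ (R x (D x u)) (R y (D y v)) := by
    intro x y u v
    rw [← hf, add_apply, inner_add_right, ContinuousLinearMap.adjoint_inner_right]
  -- Because `R x₀ = 0`, the inner products involving `D x₀` are values of `f(x) + f(y)^*`;
  -- expanding `⟨D_x - D_{x₀}, D_y - D_{x₀}⟩` cancels all of these and leaves `⟨R_x D_x, R_y D_y⟩`.
  obtain ⟨W, hW, hWa⟩ := exists_contraction_of_gram_eq
    (fun p : Y × E => R p.1 (D p.1 p.2)) (fun p => D p.1 p.2 - D x₀ p.2) (by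
      rintro ⟨x, u⟩ ⟨y, v⟩
      have h1 := hf' x y u v
      have h2 := hf' x x₀ u v
      have h3 := hf' x₀ y u v
      have h4 := hf' x₀ x₀ u v
      simp only [hx₀, zero_apply, inner_zero_left, inner_zero_right, sub_zero] at h2 h3 h4
      simp only [inner_sub_left, inner_sub_right, ← h2, ← h3, ← h4]
      linear_combination h1)
  have hWR : ∀ x, ‖W * R x‖ < 1 := fun x =>
    (norm_mul_le _ _).trans_lt ((mul_le_of_le_one_left (norm_nonneg _) hW).trans_lt (hR x))
  -- The relation `(1 - W R_x) D_x = D_{x₀}` holds on `Y`; here it is solved on all of `X` by a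
  -- Neumann series.
  let D' : X → E →L[ℂ] H := fun x =>
    ((Units.oneSub (W * R x) (hWR x))⁻¹ : (H →L[ℂ] H)ˣ).val ∘L D x₀
  have hD' : ∀ x u, D' x u - W (R x (D' x u)) = D x₀ u := by
    intro x u
    have : ((Units.oneSub (W * R x) (hWR x)) : H →L[ℂ] H) *
        ((Units.oneSub (W * R x) (hWR x))⁻¹ : (H →L[ℂ] H)ˣ).val = 1 := Units.mul_inv _
    have := congrArg (fun T : H →L[ℂ] H => T (D x₀ u)) this
    simpa [D'] using this
  have hDY : ∀ (y : Y) u, D' y u = D y u := by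
    intro y u
    have h0 : ((Units.oneSub (W * R y) (hWR y)) : H →L[ℂ] H) (D y u) = D x₀ u := by
      have := hWa (y, u)
      simp only at this
      simp [this]
    have : ((Units.oneSub (W * R y) (hWR y))⁻¹ : (H →L[ℂ] H)ˣ).val *
        ((Units.oneSub (W * R y) (hWR y)) : H →L[ℂ] H) = 1 := Units.inv_mul _
    have := congrArg (fun T : H →L[ℂ] H => T (D y u)) this
    change _ = D y u at this
    rw [← this]
    exact congrArg ((Units.oneSub (W * R y) (hWR y))⁻¹ : (H →L[ℂ] H)ˣ).val h0.symm
  refine ⟨fun x => ContinuousLinearMap.adjoint (D' x) ∘L D x₀ - ContinuousLinearMap.adjoint (f x₀),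
    D', W, hW, fun y => ?_, fun x y u v => ?_⟩
  · ext v
    refine ext_inner_left ℂ fun u => ?_
    have h2 := hf' y x₀ u v
    simp only [hx₀, zero_apply, inner_zero_right, sub_zero] at h2
    simp only [sub_apply, ContinuousLinearMap.comp_apply, inner_sub_right,
      ContinuousLinearMap.adjoint_inner_right, hDY]
    linear_combination -h2
  · have h4 := hf' x₀ x₀ u v
    simp only [hx₀, zero_apply, inner_zero_right, sub_zero] at h4
    have hu : W (R x (D' x u)) = D' x u - D x₀ u := by rw [← hD' x u]; abel
    have hv : W (R y (D' y v)) = D' y v - D x₀ v := by rw [← hD' y v]; abel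
    rw [hu, hv]
    simp only [add_apply, sub_apply, ContinuousLinearMap.comp_apply, inner_add_right,
      inner_sub_right, inner_sub_left, ContinuousLinearMap.adjoint_inner_right,
      map_sub, ContinuousLinearMap.adjoint_adjoint,
      ContinuousLinearMap.adjoint_comp]
    linear_combination -h4

end Hilbert

theorem sum_sum_equivFin_symm {α M : Type*} [AddCommMonoid M] (s : Finset α) (G : α → α → M) :
    ∑ i, ∑ j, G (s.equivFin.symm i) (s.equivFin.symm j) = ∑ a ∈ s, ∑ b ∈ s, G a b := by
  have h : ∀ F : α → M, ∑ i, F (s.equivFin.symm i) = ∑ a ∈ s, F a := fun F =>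
    (Equiv.sum_comp s.equivFin.symm fun a : s => F a).trans (Finset.sum_coe_sort s F)
  rw [h fun a => ∑ j, G a (s.equivFin.symm j)]
  exact Finset.sum_congr rfl fun a _ => h (G a)

/-! ### Factorisation of positive matrices over the bounded continuous functions. -/

section Sqrt

open scoped Matrix.Norms.L2Operator MatrixOrder in
/-- A continuous family of positive semidefinite matrices has a continuous square root. -/
theorem exists_continuous_sqrt {S : Type*} [TopologicalSpace S] {n : ℕ}
    (B : S → Matrix (Fin n) (Fin n) ℂ) (hB : Continuous B) (hpos : ∀ s, (B s).PosSemidef) :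
    ∃ C : S → Matrix (Fin n) (Fin n) ℂ, Continuous C ∧ ∀ s, B s = (C s).conjTranspose * C s := by
  refine ⟨fun s => cfc NNReal.sqrt (B s), ?_, fun s => ?_⟩
  · exact Continuous.cfc_nnreal_of_mem_nhdsSet (s := Set.univ) NNReal.sqrt Filter.univ_mem hB
      (fun s => (hpos s).nonneg) NNReal.continuous_sqrt.continuousOn
  · have h0 : 0 ≤ B s := (hpos s).nonneg
    have h1 : star (CFC.sqrt (B s)) = CFC.sqrt (B s) :=
      (IsSelfAdjoint.of_nonneg (CFC.sqrt_nonneg (B s))).star_eq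
    change B s = (cfc NNReal.sqrt (B s)).conjTranspose * cfc NNReal.sqrt (B s)
    rw [← CFC.sqrt_eq_cfc, ← Matrix.star_eq_conjTranspose, h1, CFC.sqrt_mul_sqrt_self _ h0]

/-- The pointwise root stays bounded because `∑_l |C_lj|² = B_jj`. Having the factors in `C_b`
allows a representation of `C_b` to be applied to them. -/
theorem exists_boundedContinuous_sqrt {S : Type*} [TopologicalSpace S] {n : ℕ}
    (B : Fin n → Fin n → S →ᵇ ℂ)
    (hpos : ∀ s, (Matrix.of fun i j => B i j s).PosSemidef) :
    ∃ C : Fin n → Fin n → S →ᵇ ℂ, ∀ i j, B i j = ∑ l, star (C l i) * C l j := by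
  obtain ⟨C, hC, hBC⟩ := exists_continuous_sqrt (fun s => Matrix.of fun i j => B i j s)
    (continuous_matrix fun i j => (B i j).continuous) hpos
  have hBC' : ∀ s i j, B i j s = ∑ l, star (C s l i) * C s l j := by
    intro s i j
    have := congrFun (congrFun (hBC s) i) j
    simpa [Matrix.mul_apply] using this
  have hbd : ∀ l j s, ‖C s l j‖ ≤ √‖B j j‖ := by
    intro l j s
    refine Real.le_sqrt_of_sq_le ?_
    have h1 : (B j j s).re = ∑ l, ‖C s l j‖ ^ 2 := by
      rw [hBC' s j j, Complex.re_sum]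
      refine Finset.sum_congr rfl fun l _ => ?_
      rw [Complex.star_def, Complex.conj_mul']
      norm_cast
    calc ‖C s l j‖ ^ 2 ≤ ∑ l, ‖C s l j‖ ^ 2 :=
          Finset.single_le_sum (f := fun l => ‖C s l j‖ ^ 2) (fun _ _ => by positivity)
            (Finset.mem_univ l)
      _ = (B j j s).re := h1.symm
      _ ≤ ‖B j j s‖ := Complex.re_le_norm _
      _ ≤ ‖B j j‖ := (B j j).norm_coe_le_norm s
  refine ⟨fun l j => BoundedContinuousFunction.ofNormedAddCommGroup (fun s => C s l j)
    (hC.matrix_elem l j) _ (hbd l j), fun i j => ?_⟩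
  ext s
  simp [hBC' s i j, BoundedContinuousFunction.sum_apply]

end Sqrt

/-! ### Kolmogorov decomposition of completely positive kernels. -/

section GNS

variable {Z E : Type*} [NormedAddCommGroup E] [InnerProductSpace ℂ E] [CompleteSpace E]
  {Ψ : Set (Z → ℂ)}

/-- Take the rank-one operators `T i = ⟨w, ·⟩ v i` with `w` a unit vector, and evaluate at `w`. -/
theorem IsCompletelyPositiveKernel.sum_inner_nonneg {Λ : Z → Z → (Ψ →ᵇ ℂ) →L[ℂ] (E →L[ℂ] E)}
    (hΛ : IsCompletelyPositiveKernel Λ) {n : ℕ} (z : Fin n → Z) (v : Fin n → E)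
    (g : Fin n → Ψ →ᵇ ℂ) :
    0 ≤ ∑ i, ∑ j, inner ℂ (v i) (Λ (z i) (z j) (star (g i) * g j) (v j)) := by
  rcases subsingleton_or_nontrivial E with hE | hE
  · simp [Subsingleton.elim _ (0 : E)]
  obtain ⟨w, hw⟩ := exists_norm_eq E zero_le_one
  have h := hΛ n z (fun i => (innerSL ℂ w).smulRight (v i)) g
  have h3 := h.inner_nonneg_right w
  simpa [ContinuousLinearMap.adjoint_inner_right, inner_sum, sum_apply, hw] using h3

theorem isCompletelyPositiveKernel_of_sum_inner_nonneg
    {Λ : Z → Z → (Ψ →ᵇ ℂ) →L[ℂ] (E →L[ℂ] E)}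
    (h : ∀ (n : ℕ) (z : Fin n → Z) (v : Fin n → E) (g : Fin n → Ψ →ᵇ ℂ),
      0 ≤ ∑ i, ∑ j, inner ℂ (v i) (Λ (z i) (z j) (star (g i) * g j) (v j))) :
    IsCompletelyPositiveKernel Λ := by
  intro n z T g
  rw [ContinuousLinearMap.isPositive_iff_complex]
  intro w
  have h1 := h n z (fun i => T i w) g
  have h2 : inner ℂ ((∑ i, ∑ j, ContinuousLinearMap.adjoint (T i) ∘L
      Λ (z i) (z j) (star (g i) * g j) ∘L T j) w) w =
      ∑ i, ∑ j, inner ℂ (T i w) (Λ (z i) (z j) (star (g i) * g j) (T j w)) := by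
    rw [← inner_conj_symm]
    have : inner ℂ w ((∑ i, ∑ j, ContinuousLinearMap.adjoint (T i) ∘L
      Λ (z i) (z j) (star (g i) * g j) ∘L T j) w) =
      ∑ i, ∑ j, inner ℂ (T i w) (Λ (z i) (z j) (star (g i) * g j) (T j w)) := by
      simp [ContinuousLinearMap.adjoint_inner_right, sum_apply]
    rw [this]
    exact h1.star_eq
  rw [h2]
  obtain ⟨hre, him⟩ := Complex.nonneg_iff.1 h1
  exact ⟨Complex.ext rfl (by simp [← him]), hre⟩

/-- Polarisation: the two-point sum with `T = (1, c)`, less its diagonal terms, is self-adjoint for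
every `c`; `c = 1` and `c = I` separate the two off-diagonal terms. -/
theorem IsCompletelyPositiveKernel.adjoint_apply {Λ : Z → Z → (Ψ →ᵇ ℂ) →L[ℂ] (E →L[ℂ] E)}
    (hΛ : IsCompletelyPositiveKernel Λ) (x y : Z) (g h : Ψ →ᵇ ℂ) :
    ContinuousLinearMap.adjoint (Λ x y (star g * h)) = Λ y x (star h * g) := by
  have key : ∀ c : ℂ, IsSelfAdjoint (c • Λ x y (star g * h) + star c • Λ y x (star h * g)) := by
    intro c
    have h0 := fun (x : Z) (g : Ψ →ᵇ ℂ) => (hΛ 1 ![x] ![1] ![g]).isSelfAdjoint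
    have h1 := (hΛ 2 ![x, y] ![1, c • 1] ![g, h]).isSelfAdjoint
    have h2 := h0 x g
    have h3 := (IsSelfAdjoint.mul_star_self c).smul (h0 y h)
    have h4 := (h1.sub h2).sub h3
    convert! h4 using 1
    simp [Fin.sum_univ_two, ← ContinuousLinearMap.star_eq_adjoint, smul_smul]
    simp only [ContinuousLinearMap.one_def, ContinuousLinearMap.id_comp,
      ContinuousLinearMap.comp_id]
    abel
  have k1 := (key 1).star_eq
  have k2 := (key Complex.I).star_eq
  simp at k1 k2
  have k3 : -star (Λ x y (star g * h)) + star (Λ y x (star h * g)) =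
      Λ x y (star g * h) - Λ y x (star h * g) := by
    refine smul_right_injective _ Complex.I_ne_zero ?_
    simpa [smul_sub, sub_eq_add_neg] using k2
  rw [← ContinuousLinearMap.star_eq_adjoint]
  linear_combination (norm := module) (2⁻¹ : ℂ) • k1 - (2⁻¹ : ℂ) • k3

/-- The kernel on `Z × C_b(Ψ)` induced by a completely positive kernel. -/
noncomputable def inducedKernel (Λ : Z → Z → (Ψ →ᵇ ℂ) →L[ℂ] (E →L[ℂ] E)) :
    Matrix (Z × (Ψ →ᵇ ℂ)) (Z × (Ψ →ᵇ ℂ)) (E →L[ℂ] E) :=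
  Matrix.of fun p q => Λ p.1 q.1 (star p.2 * q.2)

theorem IsCompletelyPositiveKernel.posSemidef_inducedKernel
    {Λ : Z → Z → (Ψ →ᵇ ℂ) →L[ℂ] (E →L[ℂ] E)} (hΛ : IsCompletelyPositiveKernel Λ) :
    (inducedKernel Λ).PosSemidef := by
  have htfae := (RKHS.posSemidef_tfae (K := inducedKernel Λ)).out 0 2
  refine htfae.2 ⟨?_, fun vv => ?_⟩
  · ext1 p q
    exact hΛ.adjoint_apply _ _ _ _
  · let e := vv.support.equivFin
    have h := hΛ.sum_inner_nonneg (fun i => (e.symm i).1.1) (fun i => vv (e.symm i).1)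
      (fun i => (e.symm i).1.2)
    have h2 := (Complex.nonneg_iff.1 h).1
    convert! h2 using 1
    simp only [Finsupp.sum, inducedKernel, Matrix.of_apply]
    rw [sum_sum_equivFin_symm vv.support fun a b =>
      inner ℂ (vv a) (Λ a.1 b.1 (star a.2 * b.2) (vv b)), Finset.sum_comm]
    simp only [map_sum, Complex.re_sum]
    refine Finset.sum_congr rfl fun a _ => Finset.sum_congr rfl fun b _ => ?_
    exact inner_re_symm _ _

/-- GNS construction: `ρ a` acts on kernel functions by `κ(x, g) v ↦ κ(x, a g) v`, and `D x = κ(x,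
1)`. -/
theorem exists_representation_of_rkhs {Λ : Z → Z → (Ψ →ᵇ ℂ) →L[ℂ] (E →L[ℂ] E)}
    {H : Type*} [NormedAddCommGroup H] [InnerProductSpace ℂ H] [CompleteSpace H]
    [RKHS ℂ H (Z × (Ψ →ᵇ ℂ)) E] (hK : RKHS.kernel H = inducedKernel Λ) :
    ∃ (ρ : (Ψ →ᵇ ℂ) →⋆ₐ[ℂ] (H →L[ℂ] H)) (D : Z → E →L[ℂ] H),
      ∀ (x y : Z) (g : Ψ →ᵇ ℂ) (u v : E),
        inner ℂ (D x u) (ρ g (D y v)) = inner ℂ u (Λ x y g v) := by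
  let κ : Z × (Ψ →ᵇ ℂ) → E →L[ℂ] H := RKHS.kerFun H
  have hκ : ∀ p q v, κ q v p = Λ p.1 q.1 (star p.2 * q.2) v := by
    intro p q v
    rw [RKHS.kerFun_apply, hK]
    rfl
  have hinner : ∀ p q u v, inner ℂ (κ p u) (κ q v) = inner ℂ u (Λ p.1 q.1 (star p.2 * q.2) v) := by
    intro p q u v
    rw [← hκ]
    exact RKHS.kerFun_inner p u (κ q v)
  let A : (Ψ →ᵇ ℂ) → ((Z × (Ψ →ᵇ ℂ)) × E →₀ ℂ) →ₗ[ℂ] H := fun a =>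
    Finsupp.linearCombination ℂ fun i => κ (i.1.1, a * i.1.2) i.2
  have hA : ∀ a c, inner ℂ (A a c) (A a c) =
      ∑ i ∈ c.support, ∑ j ∈ c.support, star (c i) * (c j *
        inner ℂ i.2 (Λ i.1.1 j.1.1 (star i.1.2 * (star a * a) * j.1.2) j.2)) := by
    intro a c
    simp only [A, Finsupp.linearCombination_apply, Finsupp.sum]
    rw [sum_inner]
    refine Finset.sum_congr rfl fun i _ => ?_
    rw [inner_sum]
    refine Finset.sum_congr rfl fun j _ => ?_
    have : star (a * i.1.2) * (a * j.1.2) = star i.1.2 * (star a * a) * j.1.2 := by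
      rw [star_mul]; ring
    rw [inner_smul_left, inner_smul_right, hinner, this]
    rfl
  have hbd : ∀ a c, ‖A a c‖ ≤ ‖a‖ * ‖A 1 c‖ := by
    intro a c
    -- `b = √(‖a‖² - |a|²)`, so `‖A a c‖² + ‖A b c‖² = ‖a‖² ‖A 1 c‖²`; this bounds multiplication by
    -- `a`.
    obtain ⟨b, hb⟩ : ∃ b : Ψ →ᵇ ℂ, star a * a + star b * b = ((‖a‖ : ℂ) ^ 2) • 1 := by
      refine ⟨BoundedContinuousFunction.ofNormedAddCommGroup
        (fun ψ => ((√(‖a‖ ^ 2 - ‖a ψ‖ ^ 2) : ℝ) : ℂ)) (by fun_prop) ‖a‖ fun ψ => ?_, ?_⟩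
      · rw [Complex.norm_real, Real.norm_of_nonneg (Real.sqrt_nonneg _)]
        refine Real.sqrt_le_iff.2 ⟨norm_nonneg _, ?_⟩
        nlinarith [sq_nonneg ‖a ψ‖]
      · ext ψ
        have h0 : 0 ≤ ‖a‖ ^ 2 - ‖a ψ‖ ^ 2 :=
          sub_nonneg.2 (pow_le_pow_left₀ (norm_nonneg _) (a.norm_coe_le_norm ψ) 2)
        simp only [BoundedContinuousFunction.add_apply, BoundedContinuousFunction.mul_apply,
          BoundedContinuousFunction.star_apply, BoundedContinuousFunction.smul_apply,
          BoundedContinuousFunction.coe_one, Pi.one_apply,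
          BoundedContinuousFunction.coe_ofNormedAddCommGroup, Complex.star_def, Complex.conj_ofReal,
          smul_eq_mul, mul_one, ← Complex.ofReal_mul, Real.mul_self_sqrt h0, Complex.conj_mul']
        push_cast
        ring
    have h1 : inner ℂ (A a c) (A a c) + inner ℂ (A b c) (A b c) =
        (‖a‖ : ℂ) ^ 2 * inner ℂ (A 1 c) (A 1 c) := by
      rw [hA, hA, hA, Finset.mul_sum, ← Finset.sum_add_distrib]
      refine Finset.sum_congr rfl fun i _ => ?_
      rw [Finset.mul_sum, ← Finset.sum_add_distrib]
      refine Finset.sum_congr rfl fun j _ => ?_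
      rw [← mul_add, ← mul_add, ← inner_add_right, ← add_apply, ← map_add, ← add_mul, ← mul_add, hb]
      simp
      ring
    simp only [inner_self_eq_norm_sq_to_K, RCLike.ofReal_eq_complex_ofReal] at h1
    have h2 : ‖A a c‖ ^ 2 + ‖A b c‖ ^ 2 = ‖a‖ ^ 2 * ‖A 1 c‖ ^ 2 := by exact_mod_cast h1
    refine le_of_sq_le_sq ?_ (by positivity)
    nlinarith [sq_nonneg ‖A b c‖]
  have hdense : DenseRange (A 1) := by
    have h := RKHS.kerFun_dense (𝕜 := ℂ) (X := Z × (Ψ →ᵇ ℂ)) (V := E) H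
    rw [DenseRange, dense_iff_closure_eq]
    refine Set.eq_univ_of_univ_subset ?_
    have h2 : (Submodule.span ℂ {RKHS.kerFun H x v | (x : Z × (Ψ →ᵇ ℂ)) (v : E)}) ≤
        LinearMap.range (A 1) := by
      refine Submodule.span_le.2 ?_
      rintro _ ⟨p, v, rfl⟩
      exact ⟨Finsupp.single (p, v) 1, by simp [A, κ]⟩
    have h3 := Submodule.topologicalClosure_mono h2
    rw [h] at h3
    exact fun φ _ => h3 (Submodule.mem_top (x := φ))
  let T : (Ψ →ᵇ ℂ) → H →L[ℂ] H := fun a => (A a).extendOfNorm (A 1)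
  have hT : ∀ a p v, T a (κ p v) = κ (p.1, a * p.2) v := by
    intro a p v
    have := LinearMap.extendOfNorm_eq hdense ⟨‖a‖, hbd a⟩ (Finsupp.single (p, v) 1)
    simpa [A, T] using this
  have hTadj : ∀ a (φ : H) p, ContinuousLinearMap.adjoint (T a) φ p = φ (p.1, a * p.2) := by
    intro a φ p
    refine ext_inner_left ℂ fun v => ?_
    rw [← RKHS.kerFun_inner, ContinuousLinearMap.adjoint_inner_right]
    change inner ℂ (T a (κ p v)) φ = _
    rw [hT]
    exact RKHS.kerFun_inner _ _ _
  have hφadd : ∀ (φ : H) x g h, φ (x, g + h) = φ (x, g) + φ (x, h) := by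
    intro φ x g h
    refine ext_inner_left ℂ fun v => ?_
    rw [inner_add_right, ← RKHS.kerFun_inner, ← RKHS.kerFun_inner, ← RKHS.kerFun_inner,
      ← inner_add_left]
    congr 1
    refine RKHS.ext fun p => ?_
    change κ _ _ _ = (κ (x, g) v + κ (x, h) v) p
    simp [hκ, mul_add]
  have hφsmul : ∀ (φ : H) x (c : ℂ) g, φ (x, c • g) = star c • φ (x, g) := by
    intro φ x c g
    refine ext_inner_left ℂ fun v => ?_
    rw [inner_smul_right, ← RKHS.kerFun_inner, ← RKHS.kerFun_inner]
    have : κ (x, c • g) v = c • κ (x, g) v := by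
      refine RKHS.ext fun p => ?_
      simp [hκ]
    change inner ℂ (κ (x, c • g) v) φ = _ * inner ℂ (κ (x, g) v) φ
    rw [this, inner_smul_left]
    rfl
  have hTstar : ∀ a, ContinuousLinearMap.adjoint (T a) = T (star a) := by
    intro a
    refine ContinuousLinearMap.ext fun φ => ?_
    refine hdense.induction_on φ (isClosed_eq (by fun_prop) (by fun_prop)) fun c => ?_
    induction c using Finsupp.induction_linear with
    | zero => simp
    | add c d hc hd => simp only [map_add, hc, hd]
    | single i r =>
      have : A 1 (Finsupp.single i r) = r • κ i.1 i.2 := by simp [A]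
      rw [this, map_smul, map_smul, hT]
      congr 1
      refine RKHS.ext fun p => ?_
      rw [hTadj, hκ, hκ]
      simp only [star_mul]
      congr 2
      ring
  -- Adjoints act on functions by `φ(x, g) ↦ φ(x, a g)`, so defining `ρ a` as the adjoint of `T
  -- (star a)` lets the algebra identities be checked pointwise.
  let ρ : (Ψ →ᵇ ℂ) →⋆ₐ[ℂ] (H →L[ℂ] H) :=
    { toFun := fun a => ContinuousLinearMap.adjoint (T (star a))
      map_one' := by
        refine ContinuousLinearMap.ext fun φ => RKHS.ext fun p => ?_
        rw [hTadj]; simp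
      map_mul' := fun a b => by
        refine ContinuousLinearMap.ext fun φ => RKHS.ext fun p => ?_
        change _ = (ContinuousLinearMap.adjoint (T (star a))
          (ContinuousLinearMap.adjoint (T (star b)) φ)) p
        simp only [hTadj, star_mul, mul_assoc]
      map_zero' := by
        refine ContinuousLinearMap.ext fun φ => RKHS.ext fun p => ?_
        have := hφsmul φ p.1 0 0
        rw [hTadj]; simpa using this
      map_add' := fun a b => by
        refine ContinuousLinearMap.ext fun φ => RKHS.ext fun p => ?_
        rw [add_apply, RKHS.coe_add, Pi.add_apply]
        simp only [hTadj, star_add, add_mul, hφadd]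
      commutes' := fun c => by
        refine ContinuousLinearMap.ext fun φ => RKHS.ext fun p => ?_
        rw [hTadj, Algebra.algebraMap_eq_smul_one, Algebra.algebraMap_eq_smul_one, star_smul,
          star_one, smul_mul_assoc, one_mul, hφsmul, star_star, smul_apply, RKHS.coe_smul]
        rfl
      map_star' := fun a => by
        simp only [hTstar, star_star, ContinuousLinearMap.star_eq_adjoint] }
  refine ⟨ρ, fun x => κ (x, 1), ?_⟩
  intro x y g u v
  change inner ℂ _ (ContinuousLinearMap.adjoint (T (star g)) (κ (y, 1) v)) = _
  rw [hTstar, star_star, hT, hinner]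
  simp

/-- Kolmogorov decomposition of a completely positive kernel. -/
theorem IsCompletelyPositiveKernel.exists_representation.{uZ, uE} {Z : Type uZ} {E : Type uE}
    [NormedAddCommGroup E] [InnerProductSpace ℂ E] [CompleteSpace E] {Ψ : Set (Z → ℂ)}
    {Λ : Z → Z → (Ψ →ᵇ ℂ) →L[ℂ] (E →L[ℂ] E)} (hΛ : IsCompletelyPositiveKernel Λ) :
    ∃ (H : Type (max uZ uE)) (_ : NormedAddCommGroup H) (_ : InnerProductSpace ℂ H)
      (_ : CompleteSpace H) (ρ : (Ψ →ᵇ ℂ) →⋆ₐ[ℂ] (H →L[ℂ] H)) (D : Z → E →L[ℂ] H),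
      ∀ (x y : Z) (g : Ψ →ᵇ ℂ) (u v : E),
        inner ℂ (D x u) (ρ g (D y v)) = inner ℂ u (Λ x y g v) := by
  have : Fact (inducedKernel Λ).PosSemidef := ⟨hΛ.posSemidef_inducedKernel⟩
  obtain ⟨ρ, D, h⟩ := exists_representation_of_rkhs
    (RKHS.OfKernel.kernel_ofKernel (K := inducedKernel Λ))
  exact ⟨RKHS.OfKernel (inducedKernel Λ), inferInstance, inferInstance, inferInstance, ρ, D, h⟩

end GNS

/-! ### Disc automorphisms and normalisation at a base point. -/

section Mobius

theorem one_sub_conj_mul_ne_zero {a z : ℂ} (ha : ‖a‖ < 1) (hz : ‖z‖ < 1) : 1 - star a * z ≠ 0 := by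
  intro h
  have h1 : star a * z = 1 := (sub_eq_zero.1 h).symm
  have h2 : ‖a‖ * ‖z‖ = 1 := by rw [← norm_star a, ← norm_mul, h1, norm_one]
  nlinarith [norm_nonneg a, norm_nonneg z]

theorem one_sub_norm_sq_pos {a : ℂ} (ha : ‖a‖ < 1) : 0 < 1 - ‖a‖ ^ 2 := by
  nlinarith [norm_nonneg a]

/-- The disc automorphism taking `a` to `0`. -/
noncomputable def mobius (a z : ℂ) : ℂ := (z - a) / (1 - star a * z)

/-- The multiplier relating the Szegő kernels at `z` and at `mobius a z`. -/
noncomputable def mobiusFactor (a z : ℂ) : ℂ := (1 - star a * z) / (√(1 - ‖a‖ ^ 2) : ℝ)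

theorem mobiusFactor_ne_zero {a z : ℂ} (ha : ‖a‖ < 1) (hz : ‖z‖ < 1) : mobiusFactor a z ≠ 0 :=
  div_ne_zero (one_sub_conj_mul_ne_zero ha hz)
    (Complex.ofReal_ne_zero.2 (Real.sqrt_pos.2 (one_sub_norm_sq_pos ha)).ne')

theorem one_sub_mul_star_eq {a z w : ℂ} (ha : ‖a‖ < 1) (hz : ‖z‖ < 1) (hw : ‖w‖ < 1) :
    1 - z * star w = mobiusFactor a z * star (mobiusFactor a w) *
      (1 - mobius a z * star (mobius a w)) := by
  have h1 := one_sub_conj_mul_ne_zero ha hz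
  have h2 : 1 - a * star w ≠ 0 := by
    have := star_ne_zero.2 (one_sub_conj_mul_ne_zero ha hw)
    simpa [mul_comm] using this
  have hp := one_sub_norm_sq_pos ha
  have hs : ((√(1 - ‖a‖ ^ 2) : ℝ) : ℂ) ≠ 0 := Complex.ofReal_ne_zero.2 (Real.sqrt_pos.2 hp).ne'
  have hs2 : ((√(1 - ‖a‖ ^ 2) : ℝ) : ℂ) ^ 2 = 1 - a * star a := by
    rw [← Complex.ofReal_pow, Real.sq_sqrt hp.le, Complex.star_def, Complex.mul_conj']
    push_cast; ring
  have e1 : star (mobiusFactor a w) = (1 - a * star w) / (√(1 - ‖a‖ ^ 2) : ℝ) := by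
    simp [mobiusFactor]
  have e2 : star (mobius a w) = (star w - star a) / (1 - a * star w) := by simp [mobius]
  have key : ∀ p q s b : ℂ, p ≠ 0 → q ≠ 0 → s ≠ 0 →
      p / s * (q / s) * (1 - (z - a) / p * (b / q)) = (p * q - (z - a) * b) / s ^ 2 := by
    intro p q s b hp hq hs
    field_simp
  rw [e1, e2, mobiusFactor, mobius, key _ _ _ _ h1 h2 hs, eq_div_iff (pow_ne_zero 2 hs), hs2]
  ring

/-- From `1 - |mobius a z|² = (1 - |a|²)(1 - |z|²) / |1 - conj a · z|²` and `|1 - conj a · z| ≤ 2`.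
The bound is uniform in `ψ`, which keeps the normalised evaluations strictly inside the unit ball of
`C_b(Ψ)`. -/
theorem norm_mobius_le {a z : ℂ} {r s : ℝ} (hr : r < 1) (hs : s < 1) (ha : ‖a‖ ≤ r)
    (hz : ‖z‖ ≤ s) : ‖mobius a z‖ ≤ √(1 - (1 - r ^ 2) * (1 - s ^ 2) / 4) := by
  have ha' := ha.trans_lt hr
  have hz' := hz.trans_lt hs
  refine Real.le_sqrt_of_sq_le ?_
  have h := one_sub_mul_star_eq ha' hz' hz'
  have hne := one_sub_conj_mul_ne_zero ha' hz'
  have hp := one_sub_norm_sq_pos ha'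
  have h1 : 1 - ‖z‖ ^ 2 = ‖1 - star a * z‖ ^ 2 / (1 - ‖a‖ ^ 2) * (1 - ‖mobius a z‖ ^ 2) := by
    have hf : ‖mobiusFactor a z‖ ^ 2 = ‖1 - star a * z‖ ^ 2 / (1 - ‖a‖ ^ 2) := by
      rw [mobiusFactor, norm_div, div_pow, Complex.norm_real,
        Real.norm_of_nonneg (Real.sqrt_nonneg _), Real.sq_sqrt hp.le]
    rw [← hf]
    simp only [Complex.star_def, Complex.mul_conj'] at h
    exact_mod_cast h
  have h2 : ‖1 - star a * z‖ ^ 2 ≤ 4 := by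
    have : ‖1 - star a * z‖ ≤ 1 + ‖a‖ * ‖z‖ := by
      refine (norm_sub_le _ _).trans ?_
      rw [norm_one, norm_mul, norm_star]
    nlinarith [norm_nonneg a, norm_nonneg z, norm_nonneg (1 - star a * z),
      mul_nonneg (norm_nonneg a) (norm_nonneg z)]
  have h3 : 0 < ‖1 - star a * z‖ ^ 2 := by positivity
  have h4 : 1 - ‖mobius a z‖ ^ 2 = (1 - ‖a‖ ^ 2) * (1 - ‖z‖ ^ 2) / ‖1 - star a * z‖ ^ 2 := by
    rw [h1]; field_simp
  have h5 : (1 - r ^ 2) * (1 - s ^ 2) / 4 ≤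
      (1 - ‖a‖ ^ 2) * (1 - ‖z‖ ^ 2) / ‖1 - star a * z‖ ^ 2 := by
    have hr0 := (norm_nonneg a).trans ha
    have hs0 := (norm_nonneg z).trans hz
    have g1 : 1 - r ^ 2 ≤ 1 - ‖a‖ ^ 2 := by nlinarith [norm_nonneg a]
    have g2 : 1 - s ^ 2 ≤ 1 - ‖z‖ ^ 2 := by nlinarith [norm_nonneg z]
    have g3 : 0 ≤ 1 - s ^ 2 := by nlinarith
    exact div_le_div₀ (mul_nonneg hp.le (g3.trans g2)) (mul_le_mul g1 g2 g3 hp.le) h3 h2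
  linarith

variable {Z : Type*} {Ψ : Set (Z → ℂ)}

theorem IsTestFamily.norm_lt_one (hΨ : IsTestFamily Ψ) (ψ : Ψ) (z : Z) : ‖ψ.1 z‖ < 1 := by
  obtain ⟨r, hr, h⟩ := hΨ.sup_lt_one z
  exact (h _ ψ.2).trans_lt hr

theorem continuous_eval_coe (z : Z) : Continuous fun ψ : Ψ => ψ.1 z :=
  (continuous_apply z).comp continuous_subtype_val

/-- The evaluation functions, moved by disc automorphisms such that the one at `x₀` vanishes. -/
theorem IsTestFamily.exists_normalization (hΨ : IsTestFamily Ψ) (x₀ : Z) :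
    ∃ e m : Z → Ψ →ᵇ ℂ, (∀ x, ‖e x‖ < 1) ∧ e x₀ = 0 ∧ (∀ x ψ, m x ψ ≠ 0) ∧
      ∀ x y, 1 - evalFn hΨ x * star (evalFn hΨ y) = m x * star (m y) * (1 - e x * star (e y)) := by
  obtain ⟨r, hr, hr'⟩ := hΨ.sup_lt_one x₀
  choose s hs hs' using hΨ.sup_lt_one
  refine ⟨fun x => BoundedContinuousFunction.ofNormedAddCommGroup
      (fun ψ : Ψ => mobius (ψ.1 x₀) (ψ.1 x)) ?_ (√(1 - (1 - r ^ 2) * (1 - s x ^ 2) / 4))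
      fun ψ => norm_mobius_le hr (hs x) (hr' _ ψ.2) (hs' x _ ψ.2),
    fun x => BoundedContinuousFunction.ofNormedAddCommGroup
      (fun ψ : Ψ => mobiusFactor (ψ.1 x₀) (ψ.1 x)) ?_ (2 / √(1 - r ^ 2)) fun ψ => ?_,
    fun x => ?_, ?_, fun x ψ => ?_, fun x y => ?_⟩
  · have h1 := continuous_eval_coe (Ψ := Ψ) x
    have h2 := continuous_eval_coe (Ψ := Ψ) x₀
    exact (h1.sub h2).div (continuous_const.sub (h2.star.mul h1)) fun ψ =>
      one_sub_conj_mul_ne_zero (hΨ.norm_lt_one ψ x₀) (hΨ.norm_lt_one ψ x)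
  · have h1 := continuous_eval_coe (Ψ := Ψ) x
    have h2 := continuous_eval_coe (Ψ := Ψ) x₀
    exact (continuous_const.sub (h2.star.mul h1)).div
      (Complex.continuous_ofReal.comp (continuous_const.sub (h2.norm.pow 2)).sqrt) fun ψ =>
      Complex.ofReal_ne_zero.2 (Real.sqrt_pos.2 (one_sub_norm_sq_pos (hΨ.norm_lt_one ψ x₀))).ne'
  · have ha := hΨ.norm_lt_one ψ x₀
    have hz := hΨ.norm_lt_one ψ x
    have har := hr' _ ψ.2
    have hr2 : 0 < 1 - r ^ 2 := by nlinarith [norm_nonneg (ψ.1 x₀)]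
    rw [mobiusFactor, norm_div, Complex.norm_real, Real.norm_of_nonneg (Real.sqrt_nonneg _)]
    refine div_le_div₀ zero_le_two ?_ (Real.sqrt_pos.2 hr2) (Real.sqrt_le_sqrt ?_)
    · refine (norm_sub_le _ _).trans ?_
      rw [norm_one, norm_mul, norm_star]
      nlinarith [norm_nonneg (ψ.1 x₀), norm_nonneg (ψ.1 x)]
    · nlinarith [norm_nonneg (ψ.1 x₀)]
  · rcases isEmpty_or_nonempty Ψ with h | ⟨⟨ψ⟩⟩
    · have : ∀ g : Ψ →ᵇ ℂ, ‖g‖ = 0 := fun g => BoundedContinuousFunction.norm_eq_zero_of_empty g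
      rw [this]; exact one_pos
    refine (BoundedContinuousFunction.norm_ofNormedAddCommGroup_le _ (Real.sqrt_nonneg _)
      _).trans_lt ?_
    rw [Real.sqrt_lt' one_pos]
    have h1 : 0 < 1 - r ^ 2 := by
      nlinarith [norm_nonneg (ψ.1 x₀), hr' _ ψ.2]
    have h2 : 0 < 1 - s x ^ 2 := by
      nlinarith [norm_nonneg (ψ.1 x), hs' x _ ψ.2, hs x]
    nlinarith [mul_pos h1 h2]
  · ext ψ
    simp [mobius]
  · exact mobiusFactor_ne_zero (hΨ.norm_lt_one ψ x₀) (hΨ.norm_lt_one ψ x)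
  · ext ψ
    exact one_sub_mul_star_eq (hΨ.norm_lt_one ψ x₀) (hΨ.norm_lt_one ψ x) (hΨ.norm_lt_one ψ y)

end Mobius

/-! ### From a decomposition on `Y` to an extension on `X`. -/

section Extension

variable {X E : Type*} [NormedAddCommGroup E] [InnerProductSpace ℂ E] [CompleteSpace E]

/-- `f(x) + f(y)^*` has positive Schur products with the scalar matrices on finite sets of points
which are admissible for `Ψ`. -/
def IsSchurHerglotz (Ψ : Set (X → ℂ)) (F : X → E →L[ℂ] E) : Prop :=
  ∀ (n : ℕ) (z : Fin n → X) (u : Fin n → E) (κ : Matrix (Fin n) (Fin n) ℂ), κ.PosSemidef →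
    (∀ ψ ∈ Ψ, (Matrix.of fun i j => (1 - ψ (z i) * star (ψ (z j))) * κ i j).PosSemidef) →
    0 ≤ ∑ i, ∑ j, inner ℂ (u i) ((F (z i) + ContinuousLinearMap.adjoint (F (z j))) (u j)) * κ i j

theorem complex_inner_self_nonneg {H : Type*} [NormedAddCommGroup H] [InnerProductSpace ℂ H]
    (a : H) : 0 ≤ inner ℂ a a := by
  rw [inner_self_eq_norm_sq_to_K, ← RCLike.ofReal_pow, RCLike.ofReal_nonneg]
  positivity

theorem sum_sum_sum_inner_eq {H : Type*} [NormedAddCommGroup H] [InnerProductSpace ℂ H] {n : ℕ}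
    (a : Fin n → Fin n → H) :
    ∑ i, ∑ j, ∑ l, inner ℂ (a l i) (a l j) = ∑ l, inner ℂ (∑ j, a l j) (∑ j, a l j) := by
  calc _ = ∑ i, ∑ l, ∑ j, inner ℂ (a l i) (a l j) :=
        Finset.sum_congr rfl fun i _ => Finset.sum_comm
    _ = ∑ l, ∑ i, ∑ j, inner ℂ (a l i) (a l j) := Finset.sum_comm
    _ = _ := Finset.sum_congr rfl fun l _ => by
        simp only [sum_inner, inner_sum]
        exact Finset.sum_comm

theorem sum_sum_inner_mul_eq {H : Type*} [NormedAddCommGroup H] [InnerProductSpace ℂ H] {n : ℕ}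
    (c : Fin n → Fin n → ℂ) (d : Fin n → H) :
    ∑ i, ∑ j, inner ℂ (d i) (d j) * ∑ l, star (c l i) * c l j =
      ∑ l, inner ℂ (∑ j, c l j • d j) (∑ j, c l j • d j) := by
  rw [← sum_sum_sum_inner_eq fun l j => c l j • d j]
  refine Finset.sum_congr rfl fun i _ => Finset.sum_congr rfl fun j _ => ?_
  rw [Finset.mul_sum]
  refine Finset.sum_congr rfl fun l _ => ?_
  rw [inner_smul_left, inner_smul_right, Complex.star_def]
  ring

theorem HasDecompositionOn.exists_schur_extension {Ψ : Set (X → ℂ)} {hΨ : IsTestFamily Ψ}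
    {Y : Set X} {f : Y → E →L[ℂ] E} (hf : HasDecompositionOn hΨ Y f) :
    ∃ F : X → E →L[ℂ] E, IsSchurHerglotz Ψ F ∧ ∀ y : Y, F y = f y := by
  rcases isEmpty_or_nonempty Y with hY | ⟨⟨x₀⟩⟩
  · exact ⟨0, fun n z u κ _ _ => by simp, fun y => hY.elim y⟩
  obtain ⟨Λ, hΛ, hfΛ⟩ := hf
  obtain ⟨e, m, he, he0, hm, hem⟩ := hΨ.exists_normalization (x₀ : X)
  obtain ⟨H, _, _, _, ρ, D, hD⟩ := hΛ.exists_representation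
  have hρadj : ∀ g a b, inner ℂ (ρ g a) b = inner ℂ a (ρ (star g) b) := by
    intro g a b
    rw [map_star, ContinuousLinearMap.star_eq_adjoint, ContinuousLinearMap.adjoint_inner_right]
  have hmul : ∀ g h a, ρ g (ρ h a) = ρ (g * h) a := fun g h a => by rw [map_mul]; rfl
  obtain ⟨F, D', W, hW, hFf, hF⟩ := exists_extension_of_realization f
    (fun y => ρ (star (m y)) ∘L D y) (fun x => ρ (star (e x)))
    (fun x => (NonUnitalStarAlgHom.norm_apply_le ρ _).trans_lt (by rw [norm_star]; exact he x)) x₀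
    (by rw [he0]; simp) (by
      intro x y u v
      rw [hfΛ, hem, ← hD]
      simp only [ContinuousLinearMap.comp_apply, hρadj, hmul, star_mul, star_star]
      rw [← inner_sub_right, ← sub_apply, ← map_sub]
      congr 3
      ring)
  refine ⟨F, fun n z u κ hκ hκΨ => ?_, hFf⟩
  set d : Fin n → H := fun i => D' (z i) (u i)
  set r : Fin n → H := fun i => ρ (star (e (z i))) (d i)
  let B : Fin n → Fin n → Ψ →ᵇ ℂ := fun i j => κ i j • (1 - e (z i) * star (e (z j)))
  -- At each `ψ`, `B` is the admissible matrix `(1 - ψ conj ψ) κ` with row `i` and column `j`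
  -- divided by `m (z i)` and `conj m (z j)`.
  have hBpos : ∀ ψ, (Matrix.of fun i j => B i j ψ).PosSemidef := by
    intro ψ
    let w : Fin n → ℂ := fun i => (m (z i) ψ)⁻¹
    convert! (Matrix.posSemidef_vecMulVec_self_star w).hadamard (hκΨ ψ.1 ψ.2) using 1
    ext i j
    have h1 : 1 - ψ.1 (z i) * star (ψ.1 (z j)) = m (z i) ψ * star (m (z j) ψ) *
        (1 - e (z i) ψ * star (e (z j) ψ)) := congrArg (fun g : Ψ →ᵇ ℂ => g ψ) (hem (z i) (z j))
    have h2 := hm (z i) ψ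
    have h3 : star (m (z j) ψ) ≠ 0 := star_ne_zero.2 (hm (z j) ψ)
    have h4 : B i j ψ = κ i j * (1 - e (z i) ψ * star (e (z j) ψ)) := rfl
    rw [Matrix.hadamard_apply, Matrix.of_apply, Matrix.of_apply, h1, h4, Matrix.vecMulVec_apply]
    simp only [w, Pi.star_apply, star_inv₀]
    field_simp
  obtain ⟨C, hC⟩ := exists_boundedContinuous_sqrt B hBpos
  obtain ⟨c, hc⟩ : ∃ c : Fin n → Fin n → ℂ, ∀ i j, κ i j = ∑ l, star (c l i) * c l j := by
    obtain ⟨c, -, hc⟩ := exists_continuous_sqrt (fun _ : Unit => κ) continuous_const fun _ => hκ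
    exact ⟨c (), fun i j => by rw [hc (), Matrix.mul_apply]; rfl⟩
  -- The weighted form splits as `(DD - RR) + (RR - WRWR)`. The first part is `∑_l ‖∑_j ρ(C_lj)
  -- d_j‖²`; the second is non-negative since `W` is a contraction and `κ = c^* c`.
  have h1 : 0 ≤ ∑ i, ∑ j, (inner ℂ (d i) (d j) - inner ℂ (r i) (r j)) * κ i j := by
    have : ∀ i j, (inner ℂ (d i) (d j) - inner ℂ (r i) (r j)) * κ i j =
        ∑ l, inner ℂ (ρ (C l i) (d i)) (ρ (C l j) (d j)) := by
      intro i j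
      simp only [r, hρadj, hmul, star_star]
      rw [← inner_sum, ← sum_apply, ← map_sum, ← hC]
      simp only [B, map_smul, map_sub, map_one, smul_apply, sub_apply, inner_smul_right,
        inner_sub_right]
      rw [show (1 : H →L[ℂ] H) (d j) = d j from rfl]
      ring
    simp only [this]
    rw [sum_sum_sum_inner_eq fun l j => ρ (C l j) (d j)]
    exact Finset.sum_nonneg fun l _ => complex_inner_self_nonneg _
  have h2 : 0 ≤ ∑ i, ∑ j, (inner ℂ (r i) (r j) - inner ℂ (W (r i)) (W (r j))) * κ i j := by
    simp only [sub_mul, Finset.sum_sub_distrib, hc]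
    rw [sum_sum_inner_mul_eq, sum_sum_inner_mul_eq, ← Finset.sum_sub_distrib]
    refine Finset.sum_nonneg fun l _ => ?_
    simp only [← map_smul, ← map_sum, inner_self_eq_norm_sq_to_K]
    rw [← RCLike.ofReal_pow, ← RCLike.ofReal_pow, ← RCLike.ofReal_sub, RCLike.ofReal_nonneg,
      sub_nonneg]
    exact pow_le_pow_left₀ (norm_nonneg _) ((W.le_of_opNorm_le hW _).trans_eq (one_mul _)) 2
  convert! add_nonneg h1 h2 using 1
  rw [← Finset.sum_add_distrib]
  refine Finset.sum_congr rfl fun i _ => ?_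
  rw [← Finset.sum_add_distrib]
  refine Finset.sum_congr rfl fun j _ => ?_
  rw [hF]
  ring

end Extension

/-! ### Admissible kernels and the pairing with tensor Herglotz–Agler functions. -/

section Admissible

theorem sum_sum_sum_sum_comm {α β γ δ M : Type*} [AddCommMonoid M] (s : Finset α) (t : Finset β)
    (s' : Finset γ) (t' : Finset δ) (G : α → β → γ → δ → M) :
    ∑ i ∈ s, ∑ j ∈ t, ∑ p ∈ s', ∑ q ∈ t', G i j p q =
      ∑ p ∈ s', ∑ q ∈ t', ∑ i ∈ s, ∑ j ∈ t, G i j p q := by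
  have h1 : ∑ i ∈ s, ∑ j ∈ t, ∑ p ∈ s', ∑ q ∈ t', G i j p q =
      ∑ x ∈ s ×ˢ t, ∑ y ∈ s' ×ˢ t', G x.1 x.2 y.1 y.2 := by simp only [Finset.sum_product]
  have h2 : ∑ p ∈ s', ∑ q ∈ t', ∑ i ∈ s, ∑ j ∈ t, G i j p q =
      ∑ y ∈ s' ×ˢ t', ∑ x ∈ s ×ˢ t, G x.1 x.2 y.1 y.2 := by simp only [Finset.sum_product]
  rw [h1, h2, Finset.sum_comm]

variable {Z E : Type*} [NormedAddCommGroup E] [InnerProductSpace ℂ E]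

/-- A kernel is positive when its product with the inverse of a Szegő kernel is. -/
theorem isPositiveKernel_of_one_sub_smul {k : Z → Z → E →L[ℂ] E} {ψ : Z → ℂ}
    (hψ : ∀ z, ‖ψ z‖ < 1)
    (h : IsPositiveKernel fun x y => (1 - ψ x * star (ψ y)) • k x y) : IsPositiveKernel k := by
  intro n z e
  -- Rescaling the vectors by `conj ψ ^ l` and summing over `l < m` telescopes to the factor `1 - (ψ
  -- conj ψ)^m`, which tends to `1`.
  have hm : ∀ m : ℕ, 0 ≤ ∑ i, ∑ j, (1 - (ψ (z i) * star (ψ (z j))) ^ m) *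
      inner ℂ (e i) (k (z i) (z j) (e j)) := by
    intro m
    have h1 : ∀ l ∈ Finset.range m, 0 ≤ ∑ i, ∑ j, (ψ (z i) * star (ψ (z j))) ^ l *
        (1 - ψ (z i) * star (ψ (z j))) * inner ℂ (e i) (k (z i) (z j) (e j)) := by
      intro l _
      have h2 := h n z fun i => star (ψ (z i)) ^ l • e i
      convert! h2 using 1
      refine Finset.sum_congr rfl fun i _ => Finset.sum_congr rfl fun j _ => ?_
      simp only [smul_apply, map_smul, inner_smul_left, inner_smul_right, map_pow,
        Complex.star_def, Complex.conj_conj]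
      ring
    have h3 := Finset.sum_nonneg h1
    convert! h3 using 1
    rw [Finset.sum_comm (s := Finset.range m)]
    refine Finset.sum_congr rfl fun i _ => ?_
    rw [Finset.sum_comm (s := Finset.range m)]
    refine Finset.sum_congr rfl fun j _ => ?_
    rw [← Finset.sum_mul, ← Finset.sum_mul, geom_sum_mul_neg]
  refine ge_of_tendsto' (b := (0 : ℂ)) (f := fun m : ℕ => ∑ i, ∑ j,
    (1 - (ψ (z i) * star (ψ (z j))) ^ m) * inner ℂ (e i) (k (z i) (z j) (e j)))
    (x := Filter.atTop) ?_ hm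
  refine tendsto_finsetSum _ fun i _ => tendsto_finsetSum _ fun j _ => ?_
  have : ‖ψ (z i) * star (ψ (z j))‖ < 1 := by
    rw [norm_mul, norm_star]
    nlinarith [hψ (z i), hψ (z j), norm_nonneg (ψ (z i)), norm_nonneg (ψ (z j))]
  simpa using ((tendsto_pow_atTop_nhds_zero_of_norm_lt_one this).const_sub 1).mul_const
    (inner ℂ (e i) (k (z i) (z j) (e j)))

theorem exists_finite_frame (P : Finset E) : ∃ (d : ℕ) (b : Fin d → E), Orthonormal ℂ b ∧
    ∀ u ∈ P, u = ∑ α, inner ℂ (b α) u • b α := by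
  let M := Submodule.span ℂ (P : Set E)
  have : FiniteDimensional ℂ M := FiniteDimensional.span_finset ℂ P
  let b := stdOrthonormalBasis ℂ M
  refine ⟨_, fun α => (b α : E), b.orthonormal.comp_linearIsometry M.subtypeₗᵢ, fun u hu => ?_⟩
  have hu' : u ∈ M := Submodule.subset_span hu
  have := congrArg (Subtype.val) (b.sum_repr' ⟨u, hu'⟩)
  simpa using this.symm

variable [CompleteSpace E]

theorem IsTensorHerglotzAgler.sum_finset_nonneg {Ψ : Set (Z → ℂ)} {f : Z → E →L[ℂ] E}
    (hf : IsTensorHerglotzAgler Ψ f) {k : Z → Z → E →L[ℂ] E} (hk : IsAdmissibleKernel Ψ k)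
    {ι : Type*} (s : Finset ι) (z : ι → Z) (u e : ι → E) :
    0 ≤ ∑ i ∈ s, ∑ j ∈ s,
      inner ℂ (u i) ((f (z i) + ContinuousLinearMap.adjoint (f (z j))) (u j)) *
        inner ℂ (e i) (k (z i) (z j) (e j)) := by
  rw [← sum_sum_equivFin_symm s]
  exact hf k hk _ (fun i => z (s.equivFin.symm i)) (fun i => u (s.equivFin.symm i))
    fun i => e (s.equivFin.symm i)

open Classical in
/-- Pairing of a tensor Herglotz-Agler function with a finitely supported coefficient kernel. -/
theorem IsTensorHerglotzAgler.sum_pairing_nonneg {Ψ : Set (Z → ℂ)} (hΨ : IsTestFamily Ψ)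
    (hne : Ψ.Nonempty) {f : Z → E →L[ℂ] E} (hf : IsTensorHerglotzAgler Ψ f)
    (P : Finset (Z × E)) (a : Z × E → Z × E → ℂ)
    (ha : ∀ ψ ∈ Ψ, ∀ η : Z → E, 0 ≤ ∑ p ∈ P, ∑ q ∈ P, a p q *
      ((1 - ψ p.1 * star (ψ q.1)) * (inner ℂ p.2 (η p.1) * inner ℂ (η q.1) q.2))) :
    0 ≤ ∑ p ∈ P, ∑ q ∈ P, a p q *
      inner ℂ p.2 ((f p.1 + ContinuousLinearMap.adjoint (f q.1)) q.2) := by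
  obtain ⟨d, b, hbo, hb⟩ := exists_finite_frame (P.image Prod.snd)
  have hb' : ∀ p ∈ P, p.2 = ∑ α, inner ℂ (b α) p.2 • b α := fun p hp =>
    hb _ (Finset.mem_image_of_mem _ hp)
  -- A conjugation on the span of the vectors in `P`. Testing on the tensors `b α ⊗ b α` below pairs
  -- `G` with the transpose of `k`, and building `k` from the `J`-images undoes the transpose.
  let J : E → E := fun u => ∑ α, inner ℂ u (b α) • b α
  have hJ : ∀ u v, inner ℂ u (J v) = inner ℂ v (J u) := by
    intro u v
    simp only [J, inner_sum, inner_smul_right]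
    exact Finset.sum_congr rfl fun α _ => mul_comm _ _
  have hJ' : ∀ u v, inner ℂ (J u) v = inner ℂ (J v) u := by
    intro u v
    rw [← inner_conj_symm, hJ, inner_conj_symm]
  let δ : Z → Z → ℂ := fun x y => if x = y then 1 else 0
  let k : Z → Z → E →L[ℂ] E := fun x y => ∑ p ∈ P, ∑ q ∈ P,
    (δ p.1 x * δ q.1 y * a p q) • (innerSL ℂ (J q.2)).smulRight (J p.2)
  have hk : ∀ x y e e', inner ℂ e (k x y e') = ∑ p ∈ P, ∑ q ∈ P,
      δ p.1 x * δ q.1 y * a p q * (inner ℂ e (J p.2) * inner ℂ (J q.2) e') := by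
    intro x y e e'
    simp only [k, sum_apply, inner_sum]
    refine Finset.sum_congr rfl fun p _ => Finset.sum_congr rfl fun q _ => ?_
    rw [smul_apply, inner_smul_right, ContinuousLinearMap.smulRight_apply, inner_smul_right,
      innerSL_apply_apply]
    ring
  have hkψ : ∀ ψ ∈ Ψ, IsPositiveKernel fun x y => (1 - ψ x * star (ψ y)) • k x y := by
    intro ψ hψ n z e
    have h := ha ψ hψ fun x => ∑ i, δ x (z i) • J (e i)
    convert! h using 1
    simp only [smul_apply, inner_smul_right, hk, inner_sum, sum_inner, Finset.mul_sum,
      Finset.sum_mul, inner_smul_left]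
    rw [sum_sum_sum_sum_comm]
    refine Finset.sum_congr rfl fun p _ => Finset.sum_congr rfl fun q _ => ?_
    rw [Finset.sum_comm]
    refine Finset.sum_congr rfl fun j _ => Finset.sum_congr rfl fun i _ => ?_
    rw [hJ (e i), hJ' q.2]
    by_cases h1 : p.1 = z i
    · by_cases h2 : q.1 = z j
      · simp [δ, h1, h2]
        ring
      · simp [δ, h2]
    · simp [δ, h1]
  have hadm : IsAdmissibleKernel Ψ k := by
    obtain ⟨ψ, hψ⟩ := hne
    exact ⟨isPositiveKernel_of_one_sub_smul (fun z => hΨ.norm_lt_one ⟨ψ, hψ⟩ z) (hkψ ψ hψ), hkψ⟩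
  have hbJ : ∀ α u, inner ℂ (b α) (J u) = inner ℂ u (b α) := by
    intro α u
    simp [J, orthonormal_iff_ite.1 hbo]
  have hbJ' : ∀ α u, inner ℂ (J u) (b α) = inner ℂ (b α) u := by
    intro α u
    rw [← inner_conj_symm, hbJ, inner_conj_symm]
  have htrace : ∀ (G : E →L[ℂ] E) x y, ∑ α, ∑ β, inner ℂ (b α) (G (b β)) *
      inner ℂ (b α) (k x y (b β)) = ∑ p ∈ P, ∑ q ∈ P,
        δ p.1 x * δ q.1 y * a p q * inner ℂ p.2 (G q.2) := by
    intro G x y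
    simp only [hk, Finset.mul_sum]
    rw [sum_sum_sum_sum_comm]
    refine Finset.sum_congr rfl fun p hp => Finset.sum_congr rfl fun q hq => ?_
    have hG : inner ℂ p.2 (G q.2) = ∑ α, ∑ β, inner ℂ p.2 (b α) * (inner ℂ (b β) q.2 *
        inner ℂ (b α) (G (b β))) := by
      conv_lhs => rw [hb' p hp, hb' q hq]
      simp only [map_sum, map_smul, sum_inner, inner_sum, inner_smul_left, inner_smul_right,
        inner_conj_symm, Finset.mul_sum]
      rw [Finset.sum_comm]
      refine Finset.sum_congr rfl fun α _ => Finset.sum_congr rfl fun β _ => ?_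
      ring
    simp only [hG, Finset.mul_sum, hbJ, hbJ']
    refine Finset.sum_congr rfl fun α _ => Finset.sum_congr rfl fun β _ => ?_
    ring
  have h := hf.sum_finset_nonneg hadm (P.image Prod.fst ×ˢ (Finset.univ : Finset (Fin d)))
    (fun i => i.1) (fun i => b i.2) fun i => b i.2
  convert! h using 1
  simp only [Finset.sum_product]
  have h1 : ∀ x ∈ P.image Prod.fst, ∑ α, ∑ y ∈ P.image Prod.fst, ∑ β,
      inner ℂ (b α) ((f x + ContinuousLinearMap.adjoint (f y)) (b β)) *
        inner ℂ (b α) (k x y (b β)) = ∑ y ∈ P.image Prod.fst, ∑ p ∈ P, ∑ q ∈ P,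
          δ p.1 x * δ q.1 y * a p q *
            inner ℂ p.2 ((f x + ContinuousLinearMap.adjoint (f y)) q.2) := by
    intro x _
    rw [Finset.sum_comm]
    exact Finset.sum_congr rfl fun y _ => htrace _ x y
  rw [Finset.sum_congr rfl h1, sum_sum_sum_sum_comm]
  refine Finset.sum_congr rfl fun p hp => Finset.sum_congr rfl fun q hq => ?_
  rw [Finset.sum_eq_single p.1, Finset.sum_eq_single q.1]
  · simp [δ]
  · intro y _ hy
    simp [δ, hy.symm]
  · exact fun hn => (hn (Finset.mem_image_of_mem _ hq)).elim
  · intro x _ hx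
    simp [δ, hx.symm]
  · exact fun hn => (hn (Finset.mem_image_of_mem _ hp)).elim

end Admissible

/-! ### The Riesz extension argument on formal kernels. -/

section Decomposition

variable {X E : Type*} [NormedAddCommGroup E] [InnerProductSpace ℂ E]

variable (E) in
/-- Formal combinations of pairs of vectors `u ∈ E` attached to points of `X`, with coefficients
in `C_b(Ψ)`. -/
abbrev FormalKernel (Ψ : Set (X → ℂ)) := ((X × E) × (X × E)) →₀ (Ψ →ᵇ ℂ)

variable {Ψ : Set (X → ℂ)}

/-- Evaluation of a formal kernel at a test function and a section `η`. -/
noncomputable def testForm (ψ : Ψ) (η : X → E) : FormalKernel E Ψ →ₗ[ℂ] ℂ :=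
  Finsupp.lsum ℂ fun i => (inner ℂ i.1.2 (η i.1.1) * inner ℂ (η i.2.1) i.2.2) •
    (BoundedContinuousFunction.evalCLM (β := ℂ) ℂ ψ).toLinearMap

@[simp]
theorem testForm_single (ψ : Ψ) (η : X → E) (i : (X × E) × (X × E)) (g : Ψ →ᵇ ℂ) :
    testForm ψ η (Finsupp.single i g) =
      inner ℂ i.1.2 (η i.1.1) * inner ℂ (η i.2.1) i.2.2 * g ψ := by
  simp [testForm]

variable (E Ψ) in
/-- Formal kernels whose evaluations have non-negative real part. -/
def positiveCone : PointedCone ℝ (FormalKernel E Ψ) where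
  carrier := {w | ∀ ψ η, 0 ≤ (testForm ψ η w).re}
  add_mem' hv hw ψ η := by
    rw [map_add, Complex.add_re]
    exact add_nonneg (hv ψ η) (hw ψ η)
  zero_mem' ψ η := by simp
  smul_mem' c w hw ψ η := by
    have : testForm ψ η (c • w) = ((c : ℝ) : ℂ) * testForm ψ η w := by
      rw [← smul_eq_mul, ← map_smul]
      rfl
    rw [this, Complex.re_ofReal_mul]
    exact mul_nonneg c.2 (hw ψ η)

/-- Formal kernels of the form `a(x, y) (1 - E(x) conj E(y))`. -/
def szegoSubmodule (hΨ : IsTestFamily Ψ) (E : Type*) : Submodule ℝ (FormalKernel E Ψ) where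
  carrier := {w | ∀ i, ∃ c : ℂ, w i = c • (1 - evalFn hΨ i.1.1 * star (evalFn hΨ i.2.1))}
  add_mem' hv hw i := by
    obtain ⟨c, hc⟩ := hv i
    obtain ⟨d, hd⟩ := hw i
    exact ⟨c + d, by rw [Finsupp.add_apply, hc, hd, add_smul]⟩
  zero_mem' i := ⟨0, by simp⟩
  smul_mem' r w hw i := by
    obtain ⟨c, hc⟩ := hw i
    exact ⟨r * c, by rw [Finsupp.smul_apply, hc, mul_smul]; rfl⟩

theorem single_mem_szegoSubmodule {E : Type*} (hΨ : IsTestFamily Ψ) (p q : X × E) (c : ℂ) :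
    Finsupp.single (p, q) (c • (1 - evalFn hΨ p.1 * star (evalFn hΨ q.1))) ∈
      szegoSubmodule hΨ E := by
  classical
  intro i
  by_cases h : (p, q) = i
  · subst h
    exact ⟨c, by simp⟩
  · exact ⟨0, by simp [Finsupp.single_eq_of_ne' h]⟩

theorem one_sub_evalFn_apply (hΨ : IsTestFamily Ψ) (x y : X) (ψ : Ψ) :
    (1 - evalFn hΨ x * star (evalFn hΨ y)) ψ = 1 - ψ.1 x * star (ψ.1 y) := rfl

theorem IsTestFamily.one_sub_ne_zero (hΨ : IsTestFamily Ψ) (ψ : Ψ) (x y : X) :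
    1 - ψ.1 x * star (ψ.1 y) ≠ 0 := by
  rw [mul_comm]
  exact one_sub_conj_mul_ne_zero (hΨ.norm_lt_one ψ y) (hΨ.norm_lt_one ψ x)

/-- The diagonal Szegő elements absorb bounded functions. -/
theorem exists_szego_add_mem_positiveCone (hΨ : IsTestFamily Ψ) (w : FormalKernel E Ψ) :
    ∃ s : szegoSubmodule hΨ E, (s : FormalKernel E Ψ) + w ∈ positiveCone E Ψ := by
  induction w using Finsupp.induction_linear with
  | zero => exact ⟨0, by simp⟩
  | add v w hv hw =>
    obtain ⟨s, hs⟩ := hv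
    obtain ⟨t, ht⟩ := hw
    refine ⟨s + t, ?_⟩
    convert! add_mem hs ht using 1
    rw [Submodule.coe_add]
    abel
  | single i g =>
    obtain ⟨p, q⟩ := i
    obtain ⟨r, hr, hr'⟩ := hΨ.sup_lt_one p.1
    obtain ⟨s, hs, hs'⟩ := hΨ.sup_lt_one q.1
    -- Chosen so that `c (1 - |ψ(x)|²) ≥ ‖g‖` at the point `x` of `p`, for all `ψ`; with `d`
    -- likewise, the diagonal terms dominate `|A| |B| ‖g‖`.
    let c : ℝ := ‖g‖ / (1 - r ^ 2)
    let d : ℝ := ‖g‖ / (1 - s ^ 2)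
    refine ⟨⟨_, add_mem (single_mem_szegoSubmodule hΨ p p c) (single_mem_szegoSubmodule hΨ q q d)⟩,
      fun ψ η => ?_⟩
    have key : ∀ (t : ℝ) (x : X), t < 1 → ‖ψ.1 x‖ ≤ t →
        ‖g‖ ≤ ‖g‖ / (1 - t ^ 2) * (1 - ‖ψ.1 x‖ ^ 2) := by
      intro t x ht hx
      have h0 : 0 < 1 - t ^ 2 := by nlinarith [norm_nonneg (ψ.1 x)]
      rw [div_mul_eq_mul_div, le_div_iff₀ h0]
      refine mul_le_mul_of_nonneg_left ?_ (norm_nonneg _)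
      nlinarith [norm_nonneg (ψ.1 x)]
    set A : ℂ := inner ℂ (η p.1) p.2
    set B : ℂ := inner ℂ (η q.1) q.2
    have hA : inner ℂ p.2 (η p.1) = star A := (inner_conj_symm _ _).symm
    have hB : inner ℂ q.2 (η q.1) = star B := (inner_conj_symm _ _).symm
    simp only [map_add, testForm_single, BoundedContinuousFunction.smul_apply,
      one_sub_evalFn_apply, hA, hB, Complex.add_re, smul_eq_mul]
    have e1 : ∀ (A z : ℂ) (c : ℝ), (star A * A * (c * (1 - z * star z))).re =
        ‖A‖ ^ 2 * (c * (1 - ‖z‖ ^ 2)) := by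
      intro A z c
      rw [Complex.star_def, Complex.conj_mul', Complex.mul_conj']
      norm_cast
    change 0 ≤ (star A * A * (c * (1 - ψ.1 p.1 * star (ψ.1 p.1)))).re +
      (star B * B * (d * (1 - ψ.1 q.1 * star (ψ.1 q.1)))).re + (star A * B * g ψ).re
    rw [e1, e1]
    have h1 := mul_le_mul_of_nonneg_left (key r p.1 hr (hr' _ ψ.2)) (sq_nonneg ‖A‖)
    have h2 := mul_le_mul_of_nonneg_left (key s q.1 hs (hs' _ ψ.2)) (sq_nonneg ‖B‖)
    have h3 : -(‖A‖ * ‖B‖ * ‖g‖) ≤ (star A * B * g ψ).re := by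
      have := Complex.abs_re_le_norm (star A * B * g ψ)
      rw [norm_mul, norm_mul, norm_star] at this
      have h4 := mul_le_mul_of_nonneg_left (g.norm_coe_le_norm ψ)
        (mul_nonneg (norm_nonneg A) (norm_nonneg B))
      linarith [neg_abs_le (star A * B * g ψ).re]
    have h5 : ‖A‖ * ‖B‖ * ‖g‖ ≤ ‖A‖ ^ 2 * ‖g‖ + ‖B‖ ^ 2 * ‖g‖ := by
      nlinarith [norm_nonneg g, mul_nonneg (norm_nonneg g) (sq_nonneg (‖A‖ - ‖B‖)),
        mul_nonneg (norm_nonneg g) (sq_nonneg ‖A‖), mul_nonneg (norm_nonneg g) (sq_nonneg ‖B‖)]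
    linarith

variable [CompleteSpace E]

-- Dividing by the Szegő factor at `ψ₀` recovers the scalar coefficients `a`. Membership in the cone
-- controls only real parts, so the pairing is applied to the Hermitian coefficients `a p q + conj
-- (a q p)`.
open Classical in
theorem IsTensorHerglotzAgler.re_pairing_nonneg (hΨ : IsTestFamily Ψ) (ψ₀ : Ψ)
    {f : X → E →L[ℂ] E} (hf : IsTensorHerglotzAgler Ψ f) {w : FormalKernel E Ψ}
    (hw : w ∈ szegoSubmodule hΨ E) (hpos : w ∈ positiveCone E Ψ) :
    0 ≤ (w.sum fun i g => g ψ₀ / (1 - ψ₀.1 i.1.1 * star (ψ₀.1 i.2.1)) *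
      inner ℂ i.1.2 ((f i.1.1 + ContinuousLinearMap.adjoint (f i.2.1)) i.2.2)).re := by
  let P : Finset (X × E) := w.support.image Prod.fst ∪ w.support.image Prod.snd
  have hP : w.support ⊆ P ×ˢ P := by
    intro i hi
    rw [Finset.mem_product]
    exact ⟨Finset.mem_union_left _ (Finset.mem_image_of_mem _ hi),
      Finset.mem_union_right _ (Finset.mem_image_of_mem _ hi)⟩
  let a : X × E → X × E → ℂ := fun p q => w (p, q) ψ₀ / (1 - ψ₀.1 p.1 * star (ψ₀.1 q.1))
  have ha : ∀ p q ψ, w (p, q) ψ = a p q * (1 - ψ.1 p.1 * star (ψ.1 q.1)) := by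
    intro p q ψ
    obtain ⟨c, hc⟩ := hw (p, q)
    have h0 := hΨ.one_sub_ne_zero ψ₀ p.1 q.1
    simp only [a, hc, BoundedContinuousFunction.smul_apply, one_sub_evalFn_apply, smul_eq_mul]
    rw [mul_div_assoc, div_self h0, mul_one]
  have hsymm : ∀ b : X × E → X × E → ℂ, (∀ p q, star (b p q) = b q p) →
      ∑ p ∈ P, ∑ q ∈ P, (a p q + star (a q p)) * b p q =
        ((2 * (∑ p ∈ P, ∑ q ∈ P, a p q * b p q).re : ℝ) : ℂ) := by
    intro b hb
    rw [← Complex.add_conj, map_sum]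
    simp only [map_sum, map_mul, add_mul, Finset.sum_add_distrib]
    congr 1
    rw [Finset.sum_comm]
    refine Finset.sum_congr rfl fun p _ => Finset.sum_congr rfl fun q _ => ?_
    rw [← hb p q]
    rfl
  have h := hf.sum_pairing_nonneg hΨ ⟨ψ₀.1, ψ₀.2⟩ P (fun p q => a p q + star (a q p)) (by
    intro ψ hψ η
    rw [hsymm _ (by intro p q; simp; ring)]
    have h1 := hpos ⟨ψ, hψ⟩ η
    rw [Complex.zero_le_real]
    refine mul_nonneg zero_le_two (h1.trans_eq ?_)
    rw [testForm, Finsupp.lsum_apply, Finsupp.sum_of_support_subset _ hP _ (by simp),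
      Finset.sum_product]
    congr 1
    refine Finset.sum_congr rfl fun p _ => Finset.sum_congr rfl fun q _ => ?_
    have := ha p q ⟨ψ, hψ⟩
    simp [this]
    ring)
  rw [hsymm _ (by
    intro p q
    rw [Complex.star_def, inner_conj_symm]
    simp only [add_apply, inner_add_left, inner_add_right, ContinuousLinearMap.adjoint_inner_left,
      ContinuousLinearMap.adjoint_inner_right]
    ring), Complex.zero_le_real] at h
  rw [Finsupp.sum_of_support_subset _ hP _ (by simp), Finset.sum_product]
  simp only [a] at h
  linarith

theorem IsTensorHerglotzAgler.exists_positive_functional (hΨ : IsTestFamily Ψ)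
    (hne : Ψ.Nonempty) {f : X → E →L[ℂ] E} (hf : IsTensorHerglotzAgler Ψ f) :
    ∃ l : FormalKernel E Ψ →ₗ[ℂ] ℂ,
      (∀ w, (∀ ψ η, 0 ≤ (testForm ψ η w).re) → 0 ≤ (l w).re) ∧
      ∀ p q : X × E,
        l (Finsupp.single (p, q) (1 - evalFn hΨ p.1 * star (evalFn hΨ q.1))) =
          inner ℂ p.2 ((f p.1 + ContinuousLinearMap.adjoint (f q.1)) q.2) := by
  obtain ⟨ψ, hψ⟩ := hne
  let ψ₀ : Ψ := ⟨ψ, hψ⟩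
  -- Evaluation at `ψ₀` defines `L` on all formal kernels, but only its restriction to
  -- `szegoSubmodule` is used, where the quotient is the coefficient itself.
  let L : FormalKernel E Ψ →ₗ[ℂ] ℂ := Finsupp.lsum ℂ fun i =>
    (inner ℂ i.1.2 ((f i.1.1 + ContinuousLinearMap.adjoint (f i.2.1)) i.2.2) /
      (1 - ψ₀.1 i.1.1 * star (ψ₀.1 i.2.1))) •
      (BoundedContinuousFunction.evalCLM (β := ℂ) ℂ ψ₀).toLinearMap
  have hL : ∀ w, L w = w.sum fun i g => g ψ₀ / (1 - ψ₀.1 i.1.1 * star (ψ₀.1 i.2.1)) *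
      inner ℂ i.1.2 ((f i.1.1 + ContinuousLinearMap.adjoint (f i.2.1)) i.2.2) := by
    intro w
    rw [Finsupp.lsum_apply]
    refine Finsupp.sum_congr fun i _ => ?_
    change _ / _ * w i ψ₀ = _
    ring
  let r : FormalKernel E Ψ →ₗ[ℝ] ℝ := Complex.reLm ∘ₗ L.restrictScalars ℝ
  obtain ⟨g, hgS, hgpos⟩ := riesz_extension (positiveCone E Ψ)
    ⟨szegoSubmodule hΨ E, r ∘ₗ (szegoSubmodule hΨ E).subtype⟩
    (fun w hw => by
      change 0 ≤ (L w).re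
      rw [hL]
      exact hf.re_pairing_nonneg hΨ ψ₀ w.2 hw)
    (exists_szego_add_mem_positiveCone hΨ)
  let l : Module.Dual ℂ (FormalKernel E Ψ) := Module.Dual.extendRCLike g
  have hre : ∀ w, (l w).re = g w := fun w => Module.Dual.re_extendRCLike_apply (𝕜 := ℂ) g w
  refine ⟨l, fun w hw => ?_, fun p q => ?_⟩
  · rw [hre]
    exact hgpos w hw
  · have h1 : ∀ c : ℂ, (l (Finsupp.single (p, q)
        (c • (1 - evalFn hΨ p.1 * star (evalFn hΨ q.1))))).re =
        (c * inner ℂ p.2 ((f p.1 + ContinuousLinearMap.adjoint (f q.1)) q.2)).re := by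
      intro c
      rw [hre]
      have h2 := hgS ⟨_, single_mem_szegoSubmodule hΨ p q c⟩
      refine h2.trans ?_
      change (L (Finsupp.single (p, q)
        (c • (1 - evalFn hΨ p.1 * star (evalFn hΨ q.1))))).re = _
      rw [hL, Finsupp.sum_single_index (by simp)]
      have h0 := hΨ.one_sub_ne_zero ψ₀ p.1 q.1
      simp only [BoundedContinuousFunction.smul_apply, one_sub_evalFn_apply, smul_eq_mul]
      rw [mul_div_assoc, div_self h0, mul_one]
    refine Complex.ext ?_ ?_
    · have h3 := h1 1
      rwa [one_smul, one_mul] at h3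
    · have h3 := h1 Complex.I
      rw [← Finsupp.smul_single, map_smul, smul_eq_mul, Complex.I_mul_re,
        Complex.I_mul_re] at h3
      exact neg_injective h3

end Decomposition

/-! ### Estimates for positive functionals on formal kernels. -/

section Functional

variable {X E : Type*} [NormedAddCommGroup E] [InnerProductSpace ℂ E] {Ψ : Set (X → ℂ)}
  {l : FormalKernel E Ψ →ₗ[ℂ] ℂ}

/-- Every complex multiple of such a `w` lies in the cone. Hence `l` sees a formal kernel only
through its evaluations. -/
theorem apply_eq_zero_of_testForm_eq_zero
    (hl : ∀ w, (∀ ψ η, 0 ≤ (testForm ψ η w).re) → 0 ≤ (l w).re) {w : FormalKernel E Ψ}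
    (hw : ∀ ψ η, testForm ψ η w = 0) : l w = 0 := by
  have key : ∀ c : ℂ, 0 ≤ (c * l w).re := by
    intro c
    have := hl (c • w) fun ψ η => by rw [map_smul, hw, smul_zero, Complex.zero_re]
    rwa [map_smul, smul_eq_mul] at this
  refine Complex.ext (le_antisymm ?_ ?_) (le_antisymm ?_ ?_)
  · simpa using key (-1)
  · simpa using key 1
  · simpa using key Complex.I
  · simpa using key (-Complex.I)

theorem apply_nonneg_of_testForm_nonneg
    (hl : ∀ w, (∀ ψ η, 0 ≤ (testForm ψ η w).re) → 0 ≤ (l w).re) {w : FormalKernel E Ψ}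
    (hw : ∀ ψ η, 0 ≤ testForm ψ η w) : 0 ≤ l w := by
  have key : ∀ c : ℂ, (∀ ψ η, 0 ≤ (c * testForm ψ η w).re) → 0 ≤ (c * l w).re := by
    intro c hc
    have := hl (c • w) fun ψ η => by rw [map_smul]; exact hc ψ η
    rwa [map_smul, smul_eq_mul] at this
  have him : ∀ ψ η, (testForm ψ η w).im = 0 := fun ψ η => ((Complex.nonneg_iff.1 (hw ψ η)).2).symm
  refine Complex.nonneg_iff.2 ⟨hl w fun ψ η => (Complex.nonneg_iff.1 (hw ψ η)).1,
    le_antisymm ?_ ?_⟩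
  · simpa using key (-Complex.I) fun ψ η => by simp [him]
  · simpa using key Complex.I fun ψ η => by simp [him]

/-- A Cauchy–Schwarz type bound: with `θ` unimodular, `‖g‖ (pp + qq) - θ g·pq` lies in the cone by
`|A| |B| ≤ |A|² + |B|²`. -/
theorem norm_apply_single_le
    (hl : ∀ w, (∀ ψ η, 0 ≤ (testForm ψ η w).re) → 0 ≤ (l w).re) (p q : X × E) (g : Ψ →ᵇ ℂ) :
    ‖l (Finsupp.single (p, q) g)‖ ≤ ‖g‖ * ((l (Finsupp.single (p, p) 1)).re +
      (l (Finsupp.single (q, q) 1)).re) := by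
  obtain ⟨θ, hθ, hθl⟩ := RCLike.exists_norm_eq_mul_self (l (Finsupp.single (p, q) g))
  have h := hl (((‖g‖ : ℝ) : ℂ) • (Finsupp.single (p, p) 1 + Finsupp.single (q, q) 1) -
    θ • Finsupp.single (p, q) g) (by
      intro ψ η
      set A : ℂ := inner ℂ (η p.1) p.2
      set B : ℂ := inner ℂ (η q.1) q.2
      have hA : inner ℂ p.2 (η p.1) = star A := (inner_conj_symm _ _).symm
      have hB : inner ℂ q.2 (η q.1) = star B := (inner_conj_symm _ _).symm
      simp only [map_sub, map_add, map_smul, testForm_single, hA, hB, smul_eq_mul]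
      change 0 ≤ (((‖g‖ : ℝ) : ℂ) * (star A * A * 1 + star B * B * 1) -
        θ * (star A * B * g ψ)).re
      have e1 : ∀ A : ℂ, star A * A * 1 = ((‖A‖ ^ 2 : ℝ) : ℂ) := by
        intro A
        rw [mul_one, Complex.star_def, Complex.conj_mul']
        norm_cast
      rw [e1, e1, ← Complex.ofReal_add, ← Complex.ofReal_mul, Complex.sub_re, Complex.ofReal_re]
      have h3 : (θ * (star A * B * g ψ)).re ≤ ‖A‖ * ‖B‖ * ‖g‖ := by
        refine (Complex.re_le_norm _).trans ?_
        rw [norm_mul, norm_mul, norm_mul, norm_star, hθ, one_mul]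
        exact mul_le_mul_of_nonneg_left (g.norm_coe_le_norm ψ) (by positivity)
      nlinarith [norm_nonneg g, mul_nonneg (norm_nonneg g) (sq_nonneg (‖A‖ - ‖B‖)),
        mul_nonneg (norm_nonneg g) (sq_nonneg ‖A‖), mul_nonneg (norm_nonneg g) (sq_nonneg ‖B‖)])
  rw [map_sub, map_smul, map_smul, map_add, smul_eq_mul, smul_eq_mul, ← hθl, Complex.sub_re,
    Complex.re_ofReal_mul, Complex.add_re, RCLike.ofReal_eq_complex_ofReal,
    Complex.ofReal_re] at h
  linarith

/-- On the diagonal, `1 ≤ (1 - r²)⁻¹ (1 - |ψ(x)|²)`. This compares the unknown value at `1` with a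
prescribed value of `l`. -/
theorem re_apply_single_one_le (hΨ : IsTestFamily Ψ)
    (hl : ∀ w, (∀ ψ η, 0 ≤ (testForm ψ η w).re) → 0 ≤ (l w).re) (x : X) :
    ∃ c : ℝ, 0 ≤ c ∧ ∀ u : E, (l (Finsupp.single ((x, u), (x, u)) 1)).re ≤
      c * (l (Finsupp.single ((x, u), (x, u)) (1 - evalFn hΨ x * star (evalFn hΨ x)))).re := by
  rcases isEmpty_or_nonempty Ψ with hE | ⟨⟨ψ₀⟩⟩
  · refine ⟨0, le_rfl, fun u => ?_⟩
    rw [apply_eq_zero_of_testForm_eq_zero hl fun ψ => hE.elim ψ]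
    simp
  obtain ⟨r, hr, hr'⟩ := hΨ.sup_lt_one x
  have h0 : 0 < 1 - r ^ 2 := by nlinarith [norm_nonneg (ψ₀.1 x), hr' _ ψ₀.2]
  refine ⟨(1 - r ^ 2)⁻¹, by positivity, fun u => ?_⟩
  have h := hl ((((1 - r ^ 2)⁻¹ : ℝ) : ℂ) • Finsupp.single ((x, u), (x, u))
    (1 - evalFn hΨ x * star (evalFn hΨ x)) - Finsupp.single ((x, u), (x, u)) 1) (by
      intro ψ η
      set A : ℂ := inner ℂ (η x) u
      have hA : inner ℂ u (η x) = star A := (inner_conj_symm _ _).symm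
      simp only [map_sub, map_smul, testForm_single, hA, smul_eq_mul, one_sub_evalFn_apply]
      change 0 ≤ ((((1 - r ^ 2)⁻¹ : ℝ) : ℂ) * (star A * A * (1 - ψ.1 x * star (ψ.1 x))) -
        star A * A * 1).re
      rw [Complex.star_def, Complex.conj_mul', Complex.mul_conj']
      norm_cast
      have h2 : 1 ≤ (1 - r ^ 2)⁻¹ * (1 - ‖ψ.1 x‖ ^ 2) := by
        rw [inv_mul_eq_div, le_div_iff₀ h0]
        nlinarith [norm_nonneg (ψ.1 x), hr' _ ψ.2]
      nlinarith [mul_le_mul_of_nonneg_left h2 (sq_nonneg ‖A‖)])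
  rw [map_sub, map_smul, smul_eq_mul, Complex.sub_re, Complex.re_ofReal_mul] at h
  linarith

end Functional

/-! ### Reading the functional as a completely positive kernel. -/

section Sesquilinear

variable {X E : Type*} [NormedAddCommGroup E] [InnerProductSpace ℂ E] {Ψ : Set (X → ℂ)}
  {l : FormalKernel E Ψ →ₗ[ℂ] ℂ}

/-- Formal kernels treat vectors as mere labels; additivity and, below, homogeneity in them hold
after applying `l` because the defects have vanishing test forms. -/
theorem apply_single_add_left
    (hl : ∀ w, (∀ ψ η, 0 ≤ (testForm ψ η w).re) → 0 ≤ (l w).re) (x : X) (u u' : E) (q : X × E)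
    (g : Ψ →ᵇ ℂ) : l (Finsupp.single ((x, u + u'), q) g) =
      l (Finsupp.single ((x, u), q) g) + l (Finsupp.single ((x, u'), q) g) := by
  rw [← sub_eq_zero, ← map_add, ← map_sub]
  refine apply_eq_zero_of_testForm_eq_zero hl fun ψ η => ?_
  simp only [map_sub, map_add, testForm_single, inner_add_left]
  ring

theorem apply_single_add_right
    (hl : ∀ w, (∀ ψ η, 0 ≤ (testForm ψ η w).re) → 0 ≤ (l w).re) (p : X × E) (y : X) (v v' : E)
    (g : Ψ →ᵇ ℂ) : l (Finsupp.single (p, (y, v + v')) g) =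
      l (Finsupp.single (p, (y, v)) g) + l (Finsupp.single (p, (y, v')) g) := by
  rw [← sub_eq_zero, ← map_add, ← map_sub]
  refine apply_eq_zero_of_testForm_eq_zero hl fun ψ η => ?_
  simp only [map_sub, map_add, testForm_single, inner_add_right]
  ring

theorem apply_single_smul_left
    (hl : ∀ w, (∀ ψ η, 0 ≤ (testForm ψ η w).re) → 0 ≤ (l w).re) (x : X) (c : ℂ) (u : E)
    (q : X × E) (g : Ψ →ᵇ ℂ) : l (Finsupp.single ((x, c • u), q) g) =
      starRingEnd ℂ c • l (Finsupp.single ((x, u), q) g) := by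
  rw [← sub_eq_zero, ← map_smul, ← map_sub]
  refine apply_eq_zero_of_testForm_eq_zero hl fun ψ η => ?_
  simp only [map_sub, map_smul, testForm_single, inner_smul_left, smul_eq_mul]
  ring

theorem apply_single_smul_right
    (hl : ∀ w, (∀ ψ η, 0 ≤ (testForm ψ η w).re) → 0 ≤ (l w).re) (p : X × E) (y : X) (c : ℂ) (v : E)
    (g : Ψ →ᵇ ℂ) : l (Finsupp.single (p, (y, c • v)) g) =
      c • l (Finsupp.single (p, (y, v)) g) := by
  rw [← sub_eq_zero, ← map_smul, ← map_sub]
  refine apply_eq_zero_of_testForm_eq_zero hl fun ψ η => ?_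
  simp only [map_sub, map_smul, testForm_single, inner_smul_right, smul_eq_mul]
  ring

variable [CompleteSpace E]

/-- A bounded sesquilinear form depending linearly on a parameter is given by operators. -/
theorem exists_operator_of_sesquilinear {A : Type*} [NormedAddCommGroup A] [NormedSpace ℂ A]
    (β : E → E → A → ℂ) (C : ℝ) (hC : 0 ≤ C)
    (hadd_left : ∀ u u' v g, β (u + u') v g = β u v g + β u' v g)
    (hsmul_left : ∀ (c : ℂ) u v g, β (c • u) v g = starRingEnd ℂ c • β u v g)
    (hadd_right : ∀ u v v' g, β u (v + v') g = β u v g + β u v' g)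
    (hsmul_right : ∀ (c : ℂ) u v g, β u (c • v) g = c • β u v g)
    (hadd : ∀ u v g h, β u v (g + h) = β u v g + β u v h)
    (hsmul : ∀ (c : ℂ) u v g, β u v (c • g) = c • β u v g)
    (hbd : ∀ u v g, ‖β u v g‖ ≤ C * ‖g‖ * ‖u‖ * ‖v‖) :
    ∃ Λ : A →L[ℂ] (E →L[ℂ] E), ∀ u v g, inner ℂ u (Λ g v) = β u v g := by
  let B : A → E →L⋆[ℂ] E →L[ℂ] ℂ := fun g =>
    LinearMap.mkContinuous₂ (LinearMap.mk₂'ₛₗ (starRingEnd ℂ) (RingHom.id ℂ)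
      (fun u v => β u v g) (fun u u' v => hadd_left u u' v g) (fun c u v => hsmul_left c u v g)
      (fun u v v' => hadd_right u v v' g) (fun c u v => hsmul_right c u v g)) (C * ‖g‖)
      fun u v => hbd u v g
  let T : A → E →L[ℂ] E := fun g =>
    ContinuousLinearMap.adjoint (InnerProductSpace.continuousLinearMapOfBilin (B g))
  have hT : ∀ u v g, inner ℂ u (T g v) = β u v g := by
    intro u v g
    rw [ContinuousLinearMap.adjoint_inner_right,
      InnerProductSpace.continuousLinearMapOfBilin_apply]
    rfl
  refine ⟨LinearMap.mkContinuous
    { toFun := T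
      map_add' := fun g h => by
        ext v
        refine ext_inner_left ℂ fun u => ?_
        rw [add_apply, inner_add_right, hT, hT, hT, hadd]
      map_smul' := fun c g => by
        ext v
        refine ext_inner_left ℂ fun u => ?_
        rw [smul_apply, inner_smul_right, hT, hT, hsmul]
        rfl } C fun g => ?_, fun u v g => hT u v g⟩
  refine ContinuousLinearMap.opNorm_le_bound _ (by positivity) fun v => ?_
  change ‖T g v‖ ≤ _
  have h1 : ‖T g v‖ * ‖T g v‖ ≤ C * ‖g‖ * ‖T g v‖ * ‖v‖ := by
    rw [← inner_self_eq_norm_mul_norm (𝕜 := ℂ), hT]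
    exact (Complex.re_le_norm _).trans (hbd _ _ _)
  rcases (norm_nonneg (T g v)).eq_or_lt with h0 | h0
  · rw [← h0]; positivity
  · exact le_of_mul_le_mul_right (by linarith) h0

/-- A tensor Herglotz-Agler function has a decomposition by a completely positive kernel. -/
theorem IsTensorHerglotzAgler.exists_decomposition (hΨ : IsTestFamily Ψ) (hne : Ψ.Nonempty)
    {f : X → E →L[ℂ] E} (hf : IsTensorHerglotzAgler Ψ f) :
    ∃ Λ : X → X → (Ψ →ᵇ ℂ) →L[ℂ] (E →L[ℂ] E), IsCompletelyPositiveKernel Λ ∧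
      ∀ x y : X, f x + ContinuousLinearMap.adjoint (f y) =
        Λ x y (1 - evalFn hΨ x * star (evalFn hΨ y)) := by
  obtain ⟨l, hl, hlf⟩ := hf.exists_positive_functional hΨ hne
  have hdiag : ∀ x, ∃ M : ℝ, 0 ≤ M ∧ ∀ u : E,
      (l (Finsupp.single ((x, u), (x, u)) 1)).re ≤ M * ‖u‖ ^ 2 := by
    intro x
    obtain ⟨c, hc, h⟩ := re_apply_single_one_le hΨ hl x
    refine ⟨c * ‖f x + ContinuousLinearMap.adjoint (f x)‖, by positivity, fun u => (h u).trans ?_⟩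
    rw [mul_assoc]
    refine mul_le_mul_of_nonneg_left ?_ hc
    rw [hlf (x, u) (x, u)]
    refine (Complex.re_le_norm _).trans ((norm_inner_le_norm _ _).trans ?_)
    have := (f x + ContinuousLinearMap.adjoint (f x)).le_opNorm u
    change ‖u‖ * ‖(f x + ContinuousLinearMap.adjoint (f x)) u‖ ≤ _
    nlinarith [norm_nonneg u]
  choose M hM0 hM using hdiag
  have hbd : ∀ x y u v g, ‖l (Finsupp.single ((x, u), (y, v)) g)‖ ≤
      (M x + M y) * ‖g‖ * ‖u‖ * ‖v‖ := by
    intro x y u v g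
    -- The available bound is additive in the two vectors; normalising both turns it into a product
    -- bound.
    have hunit : ∀ u v : E, ‖u‖ = 1 → ‖v‖ = 1 →
        ‖l (Finsupp.single ((x, u), (y, v)) g)‖ ≤ (M x + M y) * ‖g‖ := by
      intro u v hu hv
      refine (norm_apply_single_le hl _ _ _).trans ?_
      rw [mul_comm]
      refine mul_le_mul_of_nonneg_right (add_le_add ?_ ?_) (norm_nonneg _)
      · simpa [hu] using hM x u
      · simpa [hv] using hM y v
    rcases eq_or_ne u 0 with rfl | hu
    · have := apply_single_smul_left hl x 0 (0 : E) (y, v) g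
      rw [zero_smul, map_zero, zero_smul] at this
      simp [this]
    rcases eq_or_ne v 0 with rfl | hv
    · have := apply_single_smul_right hl (x, u) y 0 (0 : E) g
      rw [zero_smul, zero_smul] at this
      simp [this]
    have h1 := hunit (((‖u‖⁻¹ : ℝ) : ℂ) • u) (((‖v‖⁻¹ : ℝ) : ℂ) • v)
      (by rw [norm_smul, Complex.norm_real]; simp [hu])
      (by rw [norm_smul, Complex.norm_real]; simp [hv])
    rw [apply_single_smul_left hl, apply_single_smul_right hl, norm_smul, norm_smul,
      RCLike.norm_conj, Complex.norm_real, Complex.norm_real, norm_inv, norm_inv, norm_norm,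
      norm_norm] at h1
    have hu' : 0 < ‖u‖ := norm_pos_iff.2 hu
    have hv' : 0 < ‖v‖ := norm_pos_iff.2 hv
    rw [inv_mul_le_iff₀ hu', inv_mul_le_iff₀ hv'] at h1
    linarith
  choose Λ hΛ using fun x y => exists_operator_of_sesquilinear
    (fun u v g => l (Finsupp.single ((x, u), (y, v)) g)) (M x + M y) (add_nonneg (hM0 x) (hM0 y))
    (fun u u' v g => apply_single_add_left hl x u u' (y, v) g)
    (fun c u v g => apply_single_smul_left hl x c u (y, v) g)
    (fun u v v' g => apply_single_add_right hl (x, u) y v v' g)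
    (fun c u v g => apply_single_smul_right hl (x, u) y c v g)
    (fun u v g h => by rw [Finsupp.single_add, map_add])
    (fun c u v g => by rw [← Finsupp.smul_single, map_smul])
    (hbd x y)
  refine ⟨Λ, isCompletelyPositiveKernel_of_sum_inner_nonneg fun n z v g => ?_, fun x y => ?_⟩
  · simp only [hΛ, ← map_sum]
    refine apply_nonneg_of_testForm_nonneg hl fun ψ η => ?_
    simp only [map_sum, testForm_single]
    -- Each evaluation of the complete positivity sum is `|∑ ⟨η(z_i), v_i⟩ g_i(ψ)|²`.
    have : ∑ i, ∑ j, inner ℂ (v i) (η (z i)) * inner ℂ (η (z j)) (v j) * (star (g i) * g j) ψ =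
        star (∑ i, inner ℂ (η (z i)) (v i) * g i ψ) * ∑ j, inner ℂ (η (z j)) (v j) * g j ψ := by
      rw [star_sum, Finset.sum_mul_sum]
      refine Finset.sum_congr rfl fun i _ => Finset.sum_congr rfl fun j _ => ?_
      simp only [BoundedContinuousFunction.mul_apply, BoundedContinuousFunction.star_apply,
        star_mul, Complex.star_def, inner_conj_symm]
      ring
    rw [this]
    exact star_mul_self_nonneg _
  · ext v
    refine ext_inner_left ℂ fun u => ?_
    rw [hΛ]
    exact (hlf (x, u) (y, v)).symm

end Sesquilinear

/-! ### Positive kernels and positive semidefinite matrices. -/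

section Matrices

theorem posSemidef_of_sum_nonneg {n : ℕ} {A : Matrix (Fin n) (Fin n) ℂ}
    (h : ∀ x : Fin n → ℂ, 0 ≤ ∑ i, ∑ j, star (x i) * (A i j * x j)) : A.PosSemidef := by
  rw [← Matrix.isPositive_toEuclideanLin_iff, LinearMap.isPositive_iff_complex]
  intro x
  have h1 : inner ℂ (A.toEuclideanLin x) x = ∑ i, ∑ j, star (x i) * (A i j * x j) := by
    rw [← inner_conj_symm]
    have : inner ℂ x (A.toEuclideanLin x) = ∑ i, ∑ j, star (x i) * (A i j * x j) := by
      rw [PiLp.inner_apply]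
      refine Finset.sum_congr rfl fun i _ => ?_
      simp [Matrix.toLpLin_apply, Matrix.mulVec, dotProduct, Finset.mul_sum, mul_comm]
    rw [this]
    exact (h x).star_eq
  rw [h1]
  obtain ⟨hre, him⟩ := Complex.nonneg_iff.1 (h x)
  exact ⟨Complex.ext rfl ((Complex.ofReal_im _).trans him), hre⟩

theorem sum_sum_nonneg_of_posSemidef {n : ℕ} {A : Matrix (Fin n) (Fin n) ℂ} (hA : A.PosSemidef) :
    0 ≤ ∑ i, ∑ j, A i j := by
  have := hA.dotProduct_mulVec_nonneg 1
  simpa [Matrix.mulVec, dotProduct] using this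

variable {Z E : Type*} [NormedAddCommGroup E] [InnerProductSpace ℂ E]

theorem IsPositiveKernel.posSemidef {k : Z → Z → E →L[ℂ] E} (hk : IsPositiveKernel k) {n : ℕ}
    (z : Fin n → Z) (e : Fin n → E) :
    (Matrix.of fun i j => inner ℂ (e i) (k (z i) (z j) (e j))).PosSemidef := by
  refine posSemidef_of_sum_nonneg fun x => ?_
  convert! hk n z fun i => x i • e i using 1
  refine Finset.sum_congr rfl fun i _ => Finset.sum_congr rfl fun j _ => ?_
  rw [map_smul, inner_smul_left, inner_smul_right, Matrix.of_apply, Complex.star_def]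
  ring

theorem IsAdmissibleKernel.posSemidef_one_sub {Ψ : Set (Z → ℂ)} {k : Z → Z → E →L[ℂ] E}
    (hk : IsAdmissibleKernel Ψ k) {n : ℕ} (z : Fin n → Z) (e : Fin n → E) (ψ : Z → ℂ) (hψ : ψ ∈ Ψ) :
    (Matrix.of fun i j => (1 - ψ (z i) * star (ψ (z j))) *
      (Matrix.of fun i j => inner ℂ (e i) (k (z i) (z j) (e j))) i j).PosSemidef := by
  convert! (hk.2 ψ hψ).posSemidef z e using 1
  ext i j
  simp

variable [CompleteSpace E]

theorem IsSchurHerglotz.isTensorHerglotzAgler {Ψ : Set (Z → ℂ)} {F : Z → E →L[ℂ] E}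
    (hF : IsSchurHerglotz Ψ F) : IsTensorHerglotzAgler Ψ F :=
  fun _ hk n z u e => hF n z u _ (hk.1.posSemidef z e) (hk.posSemidef_one_sub z e)

end Matrices

/-! ### The operator-product class consists of scalar functions. -/

section Scalar

variable {Z E : Type*} [NormedAddCommGroup E] [InnerProductSpace ℂ E]

/-- The rank-one kernel supported at the point `z₀`. -/
theorem isAdmissibleKernel_pointMass [DecidableEq Z] {Ψ : Set (Z → ℂ)}
    (hΨ : ∀ ψ ∈ Ψ, ∀ z, ‖ψ z‖ < 1)
    (z₀ : Z) (v : E) : IsAdmissibleKernel Ψ fun x y : Z =>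
      if x = z₀ ∧ y = z₀ then (innerSL ℂ v).smulRight v else 0 := by
  have key : ∀ t : Z → Z → ℂ, 0 ≤ t z₀ z₀ → IsPositiveKernel fun x y : Z => t x y •
      if x = z₀ ∧ y = z₀ then (innerSL ℂ v).smulRight v else 0 := by
    intro t ht n z e
    have h1 : ∑ i, ∑ j, inner ℂ (e i) ((t (z i) (z j) •
        if z i = z₀ ∧ z j = z₀ then (innerSL ℂ v).smulRight v else 0 : E →L[ℂ] E) (e j)) =
        t z₀ z₀ * (star (∑ i, if z i = z₀ then inner ℂ v (e i) else 0) *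
          ∑ j, if z j = z₀ then inner ℂ v (e j) else 0) := by
      rw [star_sum, Finset.sum_mul_sum, Finset.mul_sum]
      refine Finset.sum_congr rfl fun i _ => ?_
      rw [Finset.mul_sum]
      refine Finset.sum_congr rfl fun j _ => ?_
      by_cases hi : z i = z₀
      · by_cases hj : z j = z₀
        · simp only [hi, hj, and_self, if_true, smul_apply, inner_smul_right,
            ContinuousLinearMap.smulRight_apply, innerSL_apply_apply, Complex.star_def,
            inner_conj_symm]
          ring
        · simp [hj]
      · simp [hi]
    rw [h1]
    exact mul_nonneg ht (star_mul_self_nonneg _)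
  refine ⟨by simpa using key (fun _ _ => 1) zero_le_one, fun ψ hψ => key _ ?_⟩
  rw [Complex.star_def, Complex.mul_conj']
  have := one_sub_norm_sq_pos (hΨ ψ hψ z₀)
  exact_mod_cast this.le

/-- Let `w'` be the part of `w` orthogonal to `v` and `c = ⟨v, w⟩`. Testing at `e = s v - w'` gives
`s (s Re c - ‖w'‖²) ≥ 0`, which fails for small `s > 0` unless `w' = 0`. -/
theorem collinear_of_re_nonneg {v w : E} (h : ∀ e : E, 0 ≤ (inner ℂ e w * inner ℂ v e).re)
    (hv : ‖v‖ = 1) : w = inner ℂ v w • v := by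
  set c : ℂ := inner ℂ v w
  set w' := w - c • v
  have hvv : inner ℂ v v = (1 : ℂ) := by rw [inner_self_eq_norm_sq_to_K, hv]; simp
  have hvw : inner ℂ v w' = 0 := by
    rw [inner_sub_right, inner_smul_right, hvv, mul_one, sub_self]
  have hwv : inner ℂ w' v = 0 := by rw [← inner_conj_symm, hvw, map_zero]
  have hw'w : inner ℂ w' w = ((‖w'‖ ^ 2 : ℝ) : ℂ) := by
    have : w = w' + c • v := by simp [w']
    conv_lhs => rw [this]
    rw [inner_add_right, inner_smul_right, hwv, mul_zero, add_zero, inner_self_eq_norm_sq_to_K]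
    simp
  have key : ∀ s : ℝ, 0 ≤ s * (s * c.re - ‖w'‖ ^ 2) := by
    intro s
    have h1 := h ((s : ℂ) • v - w')
    have e1 : inner ℂ ((s : ℂ) • v - w') w = s * c - ((‖w'‖ ^ 2 : ℝ) : ℂ) := by
      rw [inner_sub_left, inner_smul_left, hw'w, Complex.conj_ofReal]
    have e2 : inner ℂ v ((s : ℂ) • v - w') = s := by
      rw [inner_sub_right, inner_smul_right, hvv, hvw, mul_one, sub_zero]
    rw [e1, e2, mul_comm, Complex.re_ofReal_mul, Complex.sub_re, Complex.re_ofReal_mul,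
      Complex.ofReal_re] at h1
    exact h1
  have hw0 : ‖w'‖ ^ 2 = 0 := by
    by_contra hne
    have hpos : 0 < ‖w'‖ ^ 2 := lt_of_le_of_ne (sq_nonneg _) (Ne.symm hne)
    have hc : 0 < |c.re| + 1 := by positivity
    have h1 := key (‖w'‖ ^ 2 / (2 * (|c.re| + 1)))
    have hs : 0 < ‖w'‖ ^ 2 / (2 * (|c.re| + 1)) := by positivity
    have h2 := nonneg_of_mul_nonneg_right h1 hs
    have h3 : ‖w'‖ ^ 2 / (2 * (|c.re| + 1)) * c.re ≤ ‖w'‖ ^ 2 / 2 := by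
      rw [div_mul_eq_mul_div, div_le_div_iff₀ (by positivity) two_pos]
      nlinarith [le_abs_self c.re]
    linarith
  have : w' = 0 := by simpa using hw0
  exact sub_eq_zero.1 this

variable [CompleteSpace E]

theorem adjoint_smul_one (c : ℂ) :
    ContinuousLinearMap.adjoint (c • (1 : E →L[ℂ] E)) = starRingEnd ℂ c • 1 := by
  rw [← ContinuousLinearMap.star_eq_adjoint, star_smul, star_one]
  rfl

/-- With operator products, the Herglotz-Agler class consists of scalar functions. -/
theorem IsHerglotzAgler.exists_eq_smul_one {Ψ : Set (Z → ℂ)} (hΨ : ∀ ψ ∈ Ψ, ∀ z, ‖ψ z‖ < 1)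
    {f : Z → E →L[ℂ] E} (hf : IsHerglotzAgler Ψ f) :
    ∃ φ : Z → ℂ, ∀ z, f z = φ z • 1 := by
  classical
  suffices h : ∀ z, ∃ a : ℂ, f z = a • 1 from ⟨fun z => (h z).choose, fun z => (h z).choose_spec⟩
  intro z
  have hunit : ∀ v : E, ‖v‖ = 1 → f z v = inner ℂ v (f z v) • v := by
    intro v hv
    refine collinear_of_re_nonneg (fun e => ?_) hv
    have h := hf _ (isAdmissibleKernel_pointMass hΨ z v) 1 ![z] ![e]
    have h1 := (Complex.nonneg_iff.1 h).1
    simp [ContinuousLinearMap.adjoint_inner_right] at h1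
    have h2 : (inner ℂ e v * inner ℂ (f z v) e).re = (inner ℂ e (f z v) * inner ℂ v e).re := by
      rw [← Complex.conj_re, map_mul, inner_conj_symm, inner_conj_symm, mul_comm]
    rw [Complex.mul_re, Complex.mul_re] at h2
    rw [Complex.mul_re]
    linarith
  obtain ⟨a, ha⟩ := LinearMap.exists_eq_smul_id_of_forall_notLinearIndependent
    (f := (f z).toLinearMap) (fun v => by
      rcases eq_or_ne v 0 with rfl | hv
      · exact fun h => h.ne_zero 0 rfl
      intro hli
      rw [LinearIndependent.pair_iff] at hli
      have hv' : ((‖v‖ : ℝ) : ℂ) ≠ 0 := Complex.ofReal_ne_zero.2 (norm_ne_zero_iff.2 hv)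
      have h1 := hunit (((‖v‖ : ℝ) : ℂ)⁻¹ • v) (by
        rw [norm_smul, norm_inv, Complex.norm_real, norm_norm,
          inv_mul_cancel₀ (norm_ne_zero_iff.2 hv)])
      set c : ℂ := inner ℂ (((‖v‖ : ℝ) : ℂ)⁻¹ • v) (f z (((‖v‖ : ℝ) : ℂ)⁻¹ • v))
      have h2 : f z v = c • v := by
        rw [map_smul, smul_comm] at h1
        exact smul_right_injective _ (inv_ne_zero hv') h1
      have h3 := hli (-c) 1 (by
        change -c • v + (1 : ℂ) • f z v = 0
        rw [h2]; module)
      exact one_ne_zero h3.2)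
  exact ⟨a, ContinuousLinearMap.ext fun v => congrArg (fun T : E →ₗ[ℂ] E => T v) ha⟩

/-- For scalar `f` the tensor form is the Schur product of the operator-product form with the Gram
matrix of the `u i`. -/
theorem IsHerglotzAgler.isTensorHerglotzAgler {Ψ : Set (Z → ℂ)} (hΨ : ∀ ψ ∈ Ψ, ∀ z, ‖ψ z‖ < 1)
    {f : Z → E →L[ℂ] E} (hf : IsHerglotzAgler Ψ f) : IsTensorHerglotzAgler Ψ f := by
  obtain ⟨φ, hφ⟩ := hf.exists_eq_smul_one hΨ
  intro k hk n z u e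
  have h := (hf k hk).posSemidef z e
  have h1 := sum_sum_nonneg_of_posSemidef ((Matrix.posSemidef_gram ℂ u).hadamard h)
  convert! h1 using 1
  refine Finset.sum_congr rfl fun i _ => Finset.sum_congr rfl fun j _ => ?_
  simp [hφ, adjoint_smul_one, Matrix.gram_apply, add_mul, mul_add]
  ring

/-- A scalar function with a decomposition extends to a Herglotz-Agler function. -/
theorem HasDecompositionOn.exists_herglotzAgler_extension {Ψ : Set (Z → ℂ)}
    {hΨ : IsTestFamily Ψ} {Y : Set Z} {f : Y → E →L[ℂ] E} (hf : HasDecompositionOn hΨ Y f)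
    {φ : Y → ℂ} (hφ : ∀ y, f y = φ y • 1) :
    ∃ F : Z → E →L[ℂ] E, IsHerglotzAgler Ψ F ∧ ∀ y : Y, F y = f y := by
  rcases subsingleton_or_nontrivial E with hE | hE
  · exact ⟨0, fun k _ n z e => by simp [Subsingleton.elim _ (0 : E)], fun y => by
      ext v; exact Subsingleton.elim _ _⟩
  obtain ⟨w, hw⟩ := exists_norm_eq E zero_le_one
  obtain ⟨Λ, hΛ, hfΛ⟩ := hf
  -- Compression to the unit vector `w` reduces to the Hilbert space `ℂ`, so that the extension
  -- found there is scalar.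
  let Λ' : Z → Z → (Ψ →ᵇ ℂ) →L[ℂ] (ℂ →L[ℂ] ℂ) := fun x y =>
    (innerSL ℂ w ∘L ContinuousLinearMap.apply ℂ E w ∘L Λ x y).smulRight 1
  have hΛ' : ∀ x y g a, Λ' x y g a = inner ℂ w (Λ x y g w) * a := fun x y g a => by simp [Λ']
  have hdec : HasDecompositionOn hΨ Y fun y => φ y • (1 : ℂ →L[ℂ] ℂ) := by
    refine ⟨Λ', isCompletelyPositiveKernel_of_sum_inner_nonneg fun n z v g => ?_, fun x y => ?_⟩
    · convert! hΛ.sum_inner_nonneg z (fun i => v i • w) g using 1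
      refine Finset.sum_congr rfl fun i _ => Finset.sum_congr rfl fun j _ => ?_
      rw [hΛ', map_smul, inner_smul_left, inner_smul_right]
      simp
      ring
    · ext
      rw [hΛ', ← hfΛ, hφ, hφ]
      simp [adjoint_smul_one, hw]
  obtain ⟨Φ, hΦ, hΦY⟩ := hdec.exists_schur_extension
  refine ⟨fun x => Φ x 1 • 1, fun k hk n z e => ?_, fun y => ?_⟩
  · convert! hΦ n z (fun _ => 1) _ (hk.1.posSemidef z e) (hk.posSemidef_one_sub z e) using 1
    refine Finset.sum_congr rfl fun i _ => Finset.sum_congr rfl fun j _ => ?_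
    have hadj : ContinuousLinearMap.adjoint (Φ (z j)) 1 = star (Φ (z j) 1) := by
      have := ContinuousLinearMap.adjoint_inner_right (Φ (z j)) (1 : ℂ) (1 : ℂ)
      simpa using this
    simp [adjoint_smul_one, hadj, add_mul]
  · simp [hΦY, hφ]

end Scalar

end HerglotzAgler

/-! ### The equivalence. -/

theorem mainTheorem2 {X : Type*} {E : Type*} [NormedAddCommGroup E] [InnerProductSpace ℂ E]
    [CompleteSpace E] (Ψ : Set (X → ℂ)) (hΨ : HerglotzAgler.IsTestFamily Ψ)
    (hne : Ψ.Nonempty) (Y : Set X) (f : Y → E →L[ℂ] E) :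
    (HerglotzAgler.IsHerglotzAgler (HerglotzAgler.restrictFamily Ψ Y) f →
      ((∃ F : X → E →L[ℂ] E, HerglotzAgler.IsHerglotzAgler Ψ F ∧ ∀ y : Y, F y = f y) ↔
        HerglotzAgler.HasDecompositionOn hΨ Y f)) ∧
    ((∃ F : X → E →L[ℂ] E, HerglotzAgler.IsTensorHerglotzAgler Ψ F ∧ ∀ y : Y, F y = f y) ↔
      HerglotzAgler.HasDecompositionOn hΨ Y f) := by
  have hlt : ∀ ψ ∈ Ψ, ∀ x, ‖ψ x‖ < 1 := fun ψ hψ x => hΨ.norm_lt_one ⟨ψ, hψ⟩ x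
  have htensor : ∀ F : X → E →L[ℂ] E, HerglotzAgler.IsTensorHerglotzAgler Ψ F →
      (∀ y : Y, F y = f y) → HerglotzAgler.HasDecompositionOn hΨ Y f := by
    intro F hF hFf
    obtain ⟨Λ, hΛ, h⟩ := hF.exists_decomposition hΨ hne
    exact ⟨Λ, hΛ, fun x y => by rw [← hFf, ← hFf, h]⟩
  refine ⟨fun hf => ⟨?_, fun hdec => ?_⟩, ?_, fun hdec => ?_⟩
  · rintro ⟨F, hF, hFf⟩
    exact htensor F (hF.isTensorHerglotzAgler hlt) hFf
  -- The Herglotz–Agler hypothesis on `Y` enters here: it forces `f` to be scalar, which the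
  -- existence of a decomposition alone does not provide.
  · obtain ⟨φ, hφ⟩ := hf.exists_eq_smul_one (by
      rintro _ ⟨ψ, hψ, rfl⟩ y
      exact hlt ψ hψ y)
    exact hdec.exists_herglotzAgler_extension hφ
  · rintro ⟨F, hF, hFf⟩
    exact htensor F hF hFf
  · obtain ⟨F, hF, hFf⟩ := hdec.exists_schur_extension
    exact ⟨F, hF.isTensorHerglotzAgler, hFf⟩
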